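/- Let $d\in\{1,2\}$ and $n\ge 0$, and let $G_d^n=\mathbb Z_2^n$ if $d=1$ and $G_d^n=T^n$ if $d=2$. Let $P$ be a simple convex $n$-polytope, with set $\mathcal F(P)$ of nonempty faces (including $P$ itself), and let $\pi_d\colon M\to P$ be a $dn$-dimensional $G_d^n$-manifold over $P$ (a small cover if $d=1$, a quasi-toric manifold if $d=2$). This means that $M$ is a smooth closed $dn$-manifold with a locally standard action of $G_d^n$ (every point has an invariant open neighbourhood that is diffeomorphic, equivariantly up to an automorphism of $G_d^n$, to an invariant open subset of the standard representation on $\mathbb R^n$, respectively $\mathbb C^n$), and that $\pi_d$ identifies the orbit space with $P$ as a polytope: $\pi_d$ is a continuous surjection whose fibres are exactly the orbits, and the isotropy group of each point over the relative interior of a $k$-dimensional face is isomorphic to $G_d^{n-k}$. Let $$F_{G_d^n}(M,2)=\{(x_1,x_2)\in M\times M \mid G_d^n(x_1)\cap G_d^n(x_2)=\emptyset\},\qquad X_d(M)=\bigcup_{\substack{F_1,F_2\in\mathcal F(P)\\ F_1\cap F_2=\emptyset}}\pi_d^{-1}(F_1)\times\pi_d^{-1}(F_2).$$ Then $X_d(M)\subseteq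 F_{G_d^n}(M,2)$, and there is a strong deformation retraction of $F_{G_d^n}(M,2)$ onto $X_d(M)$ that is equivariant for the coordinatewise action of $G_d^n\times G_d^n$, i.e. a continuous map $H\colon F_{G_d^n}(M,2)\times[0,1]\to F_{G_d^n}(M,2)$ with $H(x,0)=x$ and $H(x,1)\in X_d(M)$ for all $x$, with $H(x,t)=x$ for all $x\in X_d(M)$ and all $t$, and with $H(g\cdot x,t)=g\cdot H(x,t)$ for all $g\in G_d^n\times G_d^n$, all $x$ and all $t$. -/

import Mathlib

open scoped Manifold ContDiff

/-- `F` is a (nonempty) face of the convex set `P`: the set of points of `P` where some linear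
functional attains its maximum over `P`. The functional `0` shows that `P` is a face of itself. -/
def IsFace {V : Type*} [NormedAddCommGroup V] [NormedSpace ℝ V] (P F : Set V) : Prop :=
  F.Nonempty ∧ IsExposed ℝ P F

/-- The (affine) dimension of a nonempty subset of a real vector space. -/
noncomputable def affineDim {V : Type*} [NormedAddCommGroup V] [NormedSpace ℝ V]
    (F : Set V) : ℕ :=
  Module.finrank ℝ (vectorSpan ℝ F)

/-- `P` is a simple convex `n`-polytope: the convex hull of a nonempty finite set of points, of
dimension `n`, such that every vertex lies in exactly `n` facets (faces of dimension `n - 1`). -/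
structure IsSimplePolytope {V : Type*} [NormedAddCommGroup V] [NormedSpace ℝ V]
    (n : ℕ) (P : Set V) : Prop where
  nonempty : P.Nonempty
  isPolytope : ∃ s : Set V, s.Finite ∧ P = convexHull ℝ s
  dim_eq : affineDim P = n
  simple : ∀ v ∈ P.extremePoints ℝ,
    {F : Set V | IsFace P F ∧ affineDim F + 1 = n ∧ v ∈ F}.encard = n

/-- The group `G_d^n`: the `n`-fold power of the group of scalars of norm one. For `𝕜 = ℝ` (`d = 1`)
this is `{1, -1}^n`, that is the 2-torus `ℤ₂^n`; for `𝕜 = ℂ` (`d = 2`) it is the torus `T^n`. -/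
abbrev Gd (𝕜 : Type*) [RCLike 𝕜] (n : ℕ) : Type _ := Fin n → Metric.sphere (0 : 𝕜) 1

/-- The standard representation of `G_d^n` on `𝕜^n`, by coordinatewise multiplication. -/
def stdRep {𝕜 : Type*} [RCLike 𝕜] {n : ℕ} (g : Gd 𝕜 n) (z : Fin n → 𝕜) : Fin n → 𝕜 :=
  fun i => (g i : 𝕜) * z i

/-- The action of `G_d^n` on the smooth manifold `M` (modelled on `𝕜^n`, a real vector space of
dimension `dn`) is locally standard: every point has an invariant open neighbourhood which is
diffeomorphic to an open subset of `𝕜^n` in such a way that, up to an automorphism of `G_d^n`, the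
action becomes the standard representation. Diffeomorphisms from open subsets of `M` to open subsets
of `𝕜^n` are the members of the maximal smooth atlas. (In particular each group element then acts
by a smooth map.) -/
def IsLocallyStandard (𝕜 : Type*) [RCLike 𝕜] (n : ℕ) (M : Type*) [TopologicalSpace M]
    [ChartedSpace (Fin n → 𝕜) M] [MulAction (Gd 𝕜 n) M] : Prop :=
  ∀ x : M, ∃ e ∈ IsManifold.maximalAtlas 𝓘(ℝ, Fin n → 𝕜) ∞ M, ∃ φ : Gd 𝕜 n ≃ₜ* Gd 𝕜 n,
    x ∈ e.source ∧
    ∀ g : Gd 𝕜 n, ∀ y ∈ e.source, g • y ∈ e.source ∧ e (g • y) = stdRep (φ g) (e y)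

/-- `π : M → P` is a `G_d^n`-manifold over `P`, where `M` is a closed smooth `dn`-manifold:
the action is locally standard, and `π` identifies the orbit space with `P`, that is
`π` is a continuous surjection whose fibres are exactly the orbits (as `M` is compact, `M / G_d^n` is
then homeomorphic to `P`), compatibly with faces: the points over the relative interior of a
`k`-dimensional face are those with `k`-dimensional orbit, i.e. whose isotropy group has rank
`n - k`. For `𝕜 = ℝ` this is a small cover, for `𝕜 = ℂ` a quasi-toric manifold. -/
structure IsGdManifoldOver (𝕜 : Type*) [RCLike 𝕜] (n : ℕ) {M : Type*} [TopologicalSpace M]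
    [ChartedSpace (Fin n → 𝕜) M] [MulAction (Gd 𝕜 n) M]
    {V : Type*} [NormedAddCommGroup V] [NormedSpace ℝ V] (P : Set V) (π : M → P) : Prop where
  locallyStandard : IsLocallyStandard 𝕜 n M
  continuous : Continuous π
  surjective : Function.Surjective π
  fibre_eq_orbit : ∀ x y : M, π x = π y ↔ y ∈ MulAction.orbit (Gd 𝕜 n) x
  isotropy : ∀ (x : M) (F : Set V), IsFace P F → (π x : V) ∈ intrinsicInterior ℝ F →
    ∀ j : ℕ, affineDim F + j = n →
      Nonempty (MulAction.stabilizer (Gd 𝕜 n) x ≃ₜ* Gd 𝕜 j)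

/-- The orbit configuration space `F_G(M, k)`, as a subset of `M^k`. -/
def orbitConfig (G : Type*) [Group G] (M : Type*) [MulAction G M] (k : ℕ) : Set (Fin k → M) :=
  {x | ∀ i j, i ≠ j → MulAction.orbit G (x i) ∩ MulAction.orbit G (x j) = ∅}

/-- The set `X_d(M)`, the union of the sets `π⁻¹(F₁) × π⁻¹(F₂)` over all pairs of disjoint faces
`F₁`, `F₂` of `P`, as a subset of `M^2`. -/
def disjointFacePreimages {M V : Type*} [NormedAddCommGroup V] [NormedSpace ℝ V] (P : Set V)
    (π : M → P) : Set (Fin 2 → M) :=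
  ⋃ (F₁ : Set V) (F₂ : Set V) (_ : IsFace P F₁) (_ : IsFace P F₂) (_ : F₁ ∩ F₂ = ∅),
    {x | (π (x 0) : V) ∈ F₁ ∧ (π (x 1) : V) ∈ F₂}

/-- For subsets `A` and `Y` of `M^k`, where `G` acts on `M`: the homotopy `H` is a strong deformation
retraction of `Y` onto its subset `A` that is equivariant for the coordinatewise action of `G^k`
on `M^k`. -/
structure IsEquivariantStrongDeformationRetraction (G : Type*) [Group G] {M : Type*}
    [TopologicalSpace M] [MulAction G M] {k : ℕ} (Y A : Set (Fin k → M))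
    (H : Y × unitInterval → Y) : Prop where
  subset : A ⊆ Y
  invariant : ∀ (g : Fin k → G), ∀ x ∈ Y, (fun i => g i • x i) ∈ Y
  continuous : Continuous H
  map_zero : ∀ x : Y, H (x, 0) = x
  map_one : ∀ x : Y, (H (x, 1) : Fin k → M) ∈ A
  fixed : ∀ (x : Y) (t : unitInterval), (x : Fin k → M) ∈ A → H (x, t) = x
  equivariant : ∀ (g : Fin k → G) (x y : Y) (t : unitInterval),
    (y : Fin k → M) = (fun i => g i • (x : Fin k → M) i) →
      (H (y, t) : Fin k → M) = fun i => g i • (H (x, t) : Fin k → M) i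

/-!
Two points of `M` have disjoint orbits exactly if their images in `P` are distinct, so everything
happens over the set of pairs of distinct points of `P`. The proof deforms these pairs in `P`, and
lifts the deformation to `M`.

In `P`, write the polytope as an intersection of finitely many half-spaces
(`Set.Finite.exists_finite_convexHull_eq`), and assign to a pair `(p, q)` the face `E` in which the
smallest faces containing `p` and `q` intersect. If `E` is nonempty, choose `c` in its relative
interior and push `(p, q)` radially away from `(c, c)` inside `P × P` until a new inequality becomes
an equality. The points remain distinct, because the ray from a point of the (convex) diagonal
through a point off the diagonal does not meet the diagonal again; they do not leave their smallest
faces; and `E` becomes strictly smaller. Doing this for one face after the other, the large ones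
first, makes `E` empty, that is, moves the points into disjoint faces
(`exists_retraction_onto_disjoint_faces`). A pair which is already in disjoint faces never moves.

For the lift, it suffices to have a continuous equivariant way of moving a point `x` of `M` over any
point `q` of the smallest face containing `π x` (`exists_equivariant_lift`). Within one standard
chart, keep the phases of the coordinates of `x` and replace their moduli by those of the points
over `q` (`chartLift`). This is continuous although phases are undefined at `0`, because moving
towards `q` along a segment no vanishing coordinate becomes nonzero
(`chartModulus_eq_zero_of_segment`): the number of vanishing coordinates is determined by the
isotropy group, hence constant on the relative interior of a face. For the whole of `M`, traverse the
segment from `π x` to `q` in finitely many small steps, each of them within one chart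
(`liftsAlong_one`).
-/

/-! ### Polytopes as intersections of half-spaces -/

/-- The polyhedron `{x | 0 ≤ f i x for all i}` cut out by a family of affine functions. -/
def polyhedron {ι V : Type*} [AddCommGroup V] [Module ℝ V] (f : ι → V →ᵃ[ℝ] ℝ) : Set V :=
  {x | ∀ i, 0 ≤ f i x}

theorem exists_forall_mem_le_le {L U : Set ℝ} (hL : L.Finite) (hU : U.Finite)
    (h : ∀ l ∈ L, ∀ u ∈ U, l ≤ u) : ∃ t, (∀ l ∈ L, l ≤ t) ∧ ∀ u ∈ U, t ≤ u := by
  rcases L.eq_empty_or_nonempty with rfl | hne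
  · obtain ⟨t, ht⟩ := hU.bddBelow
    exact ⟨t, by simp, fun u hu => ht hu⟩
  · obtain ⟨t, ht, hmax⟩ := hL.exists_maximalFor id L hne
    refine ⟨t, fun l hl => ?_, fun u hu => h t ht u hu⟩
    rcases le_total l t with h1 | h1
    · exact h1
    · exact hmax hl h1

/-- Fourier–Motzkin elimination: the projection along `ℝ` of a subset of `V × ℝ` given by finitely
many affine inequalities `0 ≤ g x + b * t` is again given by finitely many affine inequalities. -/
theorem exists_finite_forall_nonneg_iff_exists {V : Type*} [AddCommGroup V] [Module ℝ V]
    {T : Set ((V →ᵃ[ℝ] ℝ) × ℝ)} (hT : T.Finite) :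
    ∃ S : Set (V →ᵃ[ℝ] ℝ), S.Finite ∧
      ∀ x, (∀ f ∈ S, 0 ≤ f x) ↔ ∃ t : ℝ, ∀ c ∈ T, 0 ≤ c.1 x + c.2 * t := by
  refine ⟨Prod.fst '' {c ∈ T | c.2 = 0} ∪
    (fun c : ((V →ᵃ[ℝ] ℝ) × ℝ) × ((V →ᵃ[ℝ] ℝ) × ℝ) => (-c.2.2) • c.1.1 + c.1.2 • c.2.1) ''
      ({c ∈ T | 0 < c.2} ×ˢ {c ∈ T | c.2 < 0}),
    ((hT.sep _).image _).union (((hT.sep _).prod (hT.sep _)).image _), fun x => ⟨fun h => ?_, ?_⟩⟩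
  · obtain ⟨t, ht1, ht2⟩ := exists_forall_mem_le_le
      (L := (fun c : (V →ᵃ[ℝ] ℝ) × ℝ => -c.1 x / c.2) '' {c ∈ T | 0 < c.2})
      (U := (fun c : (V →ᵃ[ℝ] ℝ) × ℝ => -c.1 x / c.2) '' {c ∈ T | c.2 < 0})
      ((hT.sep _).image _) ((hT.sep _).image _) (by
        rintro _ ⟨c, hc, rfl⟩ _ ⟨d, hd, rfl⟩
        have := h _ (Or.inr ⟨(c, d), ⟨hc, hd⟩, rfl⟩)
        have hc2 := hc.2
        have hd2 := hd.2
        simp only [AffineMap.coe_add, AffineMap.coe_smul, Pi.add_apply, Pi.smul_apply,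
          smul_eq_mul] at this
        rw [div_le_iff₀ hc2, div_mul_eq_mul_div, le_div_iff_of_neg hd2]
        nlinarith)
    refine ⟨t, fun c hc => ?_⟩
    rcases lt_trichotomy c.2 0 with h0 | h0 | h0
    · have := ht2 _ ⟨c, ⟨hc, h0⟩, rfl⟩
      rw [le_div_iff_of_neg h0] at this
      linarith
    · have := h _ (Or.inl ⟨c, ⟨hc, h0⟩, rfl⟩)
      simpa [h0] using this
    · have := ht1 _ ⟨c, ⟨hc, h0⟩, rfl⟩
      rw [div_le_iff₀ h0] at this
      linarith
  · rintro ⟨t, ht⟩ f (⟨c, ⟨hc, h0⟩, rfl⟩ | ⟨⟨c, d⟩, ⟨⟨hc, hc2⟩, hd, hd2⟩, rfl⟩)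
    · simpa [h0] using ht c hc
    · have h1 := ht c hc
      have h2 := ht d hd
      simp only [AffineMap.coe_add, AffineMap.coe_smul, Pi.add_apply, Pi.smul_apply,
        smul_eq_mul]
      dsimp only at hc2 hd2
      nlinarith

theorem AffineMap.apply_add_smul_sub {V : Type*} [AddCommGroup V] [Module ℝ V]
    (f : V →ᵃ[ℝ] ℝ) (c x : V) (s : ℝ) : f (c + s • (x - c)) = f c + s * (f x - f c) := by
  have h1 : f (s • (x - c) +ᵥ c) = f.linear (s • (x - c)) +ᵥ f c := f.map_vadd _ _
  have h2 : f ((x - c) +ᵥ c) = f.linear (x - c) +ᵥ f c := f.map_vadd _ _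
  simp only [vadd_eq_add, sub_add_cancel, map_smul, smul_eq_mul] at h1 h2
  rw [add_comm c, h1, h2]
  ring

/-- A bounded set contains no ray. -/
theorem Bornology.IsBounded.eq_of_forall_add_smul_mem {V : Type*} [NormedAddCommGroup V]
    [NormedSpace ℝ V] {Q : Set V} (hQ : Bornology.IsBounded Q) {y v x : V}
    (h : ∀ t : ℝ, 0 ≤ t → y + t • (x - v) ∈ Q) : x = v := by
  obtain ⟨R, hR⟩ := hQ.exists_norm_le
  by_contra hne
  have hpos : 0 < ‖x - v‖ := norm_pos_iff.2 (sub_ne_zero.2 hne)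
  have hR0 : 0 ≤ R := (norm_nonneg _).trans (hR _ (h 0 le_rfl))
  set t : ℝ := (R + ‖y‖ + 1) / ‖x - v‖ with ht
  have ht0 : 0 ≤ t := by positivity
  have h1 := hR _ (h t ht0)
  have h2 : ‖t • (x - v)‖ = R + ‖y‖ + 1 := by
    rw [norm_smul, Real.norm_of_nonneg ht0, ht, div_mul_cancel₀ _ hpos.ne']
  have h3 := norm_sub_le (y + t • (x - v)) y
  rw [add_sub_cancel_left, h2] at h3
  linarith

/-- **Minkowski–Weyl**: a polytope is an intersection of finitely many half-spaces. The points are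
added one at a time: `convexHull (insert v s)` is the union of the segments from `v` to the points
of `convexHull s`, and the position on the segment is eliminated by Fourier–Motzkin. -/
theorem Set.Finite.exists_finite_convexHull_eq {V : Type*} [NormedAddCommGroup V]
    [NormedSpace ℝ V] [FiniteDimensional ℝ V] {s : Set V} (hs : s.Finite) :
    ∃ S : Set (V →ᵃ[ℝ] ℝ), S.Finite ∧ convexHull ℝ s = {x | ∀ f ∈ S, 0 ≤ f x} := by
  induction s, hs using Set.Finite.induction_on with
  | empty =>
    refine ⟨{AffineMap.const ℝ V (-1)}, Set.finite_singleton _, ?_⟩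
    ext x
    simp
  | @insert v s _ hs ih =>
    obtain ⟨S, hSfin, hS⟩ := ih
    rcases s.eq_empty_or_nonempty with rfl | hne
    · let b := Module.finBasis ℝ V
      let g : Fin (Module.finrank ℝ V) → V →ᵃ[ℝ] ℝ := fun i =>
        (b.coord i).toAffineMap - AffineMap.const ℝ V (b.coord i v)
      refine ⟨Set.range g ∪ Set.range (fun i => -g i),
        (Set.finite_range _).union (Set.finite_range _), ?_⟩
      ext x
      simp only [insert_empty_eq, convexHull_singleton, Set.mem_singleton_iff, Set.mem_ofPred_eq]
      constructor
      · rintro rfl f (⟨i, rfl⟩ | ⟨i, rfl⟩) <;> simp [g]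
      · intro h
        refine b.ext_elem fun i => le_antisymm ?_ ?_
        · have := h _ (Or.inr ⟨i, rfl⟩)
          simp only [g, AffineMap.coe_neg, Pi.neg_apply, AffineMap.coe_sub, Pi.sub_apply,
            LinearMap.coe_toAffineMap, AffineMap.const_apply, Module.Basis.coord_apply] at this
          linarith
        · have := h _ (Or.inl ⟨i, rfl⟩)
          simp only [g, AffineMap.coe_sub, Pi.sub_apply,
            LinearMap.coe_toAffineMap, AffineMap.const_apply, Module.Basis.coord_apply] at this
          linarith
    · obtain ⟨S', hS'fin, hS'⟩ := exists_finite_forall_nonneg_iff_exists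
        (T := (fun f : V →ᵃ[ℝ] ℝ => (f - AffineMap.const ℝ V (f v), f v)) '' S ∪
          {(0, 1), (AffineMap.const ℝ V 1, -1)})
        ((hSfin.image _).union (Set.toFinite _))
      have hbdd : Bornology.IsBounded {x | ∀ f ∈ S, 0 ≤ f x} :=
        hS ▸ (isBounded_convexHull.2 hs.isBounded)
      obtain ⟨y₀, hy₀⟩ : {x | ∀ f ∈ S, 0 ≤ f x}.Nonempty := hS ▸ hne.convexHull
      refine ⟨S', hS'fin, ?_⟩
      ext x
      rw [convexHull_insert hne, hS, Set.mem_ofPred_eq, hS', convexJoin_singleton_left]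
      simp only [Set.mem_iUnion, exists_prop]
      constructor
      · rintro ⟨y, hy, hx⟩
        rw [segment_eq_image'] at hx
        obtain ⟨w, ⟨hw0, hw1⟩, rfl⟩ := hx
        refine ⟨w, ?_⟩
        rintro _ (⟨f, hf, rfl⟩ | rfl | rfl)
        · have := mul_nonneg hw0 (hy f hf)
          simp only [AffineMap.coe_sub, Pi.sub_apply, AffineMap.const_apply,
            AffineMap.apply_add_smul_sub]
          linarith
        · simpa using hw0
        · simpa using hw1
      · rintro ⟨w, hw⟩
        have hw0 : 0 ≤ w := by simpa using hw (0, 1) (Or.inr (Or.inl rfl))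
        have hw1 : w ≤ 1 := by
          simpa using hw (AffineMap.const ℝ V 1, -1) (Or.inr (Or.inr rfl))
        have hwf : ∀ f ∈ S, 0 ≤ f x - f v + w * f v := fun f hf => by
          have := hw _ (Or.inl ⟨f, hf, rfl⟩)
          simp only [AffineMap.coe_sub, Pi.sub_apply, AffineMap.const_apply] at this
          linarith
        rcases hw0.eq_or_lt with rfl | hpos
        · have : x = v := hbdd.eq_of_forall_add_smul_mem (y := y₀) fun t ht f hf => by
            have h1 := hwf f hf
            have h2 := hy₀ f hf
            have h3 : f (t • (x - v) +ᵥ y₀) = f.linear (t • (x - v)) +ᵥ f y₀ := f.map_vadd _ _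
            have h4 : f ((x - v) +ᵥ v) = f.linear (x - v) +ᵥ f v := f.map_vadd _ _
            simp only [vadd_eq_add, sub_add_cancel, map_smul, smul_eq_mul] at h3 h4
            rw [add_comm, h3]
            have h5 : 0 ≤ f.linear (x - v) := by linarith
            positivity
          exact ⟨y₀, hy₀, this ▸ left_mem_segment ℝ _ _⟩
        · refine ⟨v + w⁻¹ • (x - v), fun f hf => ?_, ?_⟩
          · rw [AffineMap.apply_add_smul_sub]
            have : f v + w⁻¹ * (f x - f v) = w⁻¹ * (f x - f v + w * f v) := by
              field_simp
              ring
            rw [this]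
            exact mul_nonneg (by positivity) (hwf f hf)
          · rw [segment_eq_image']
            refine ⟨w, ⟨hw0, hw1⟩, ?_⟩
            simp [smul_smul, hpos.ne']

/-! ### Faces of a polyhedron -/

/-- The set of inequalities defining the polyhedron of `f` that are equalities at `x`. The smallest
face containing `p` consists of the points `x` of the polyhedron with
`activeSet f p ⊆ activeSet f x`. -/
def activeSet {ι V : Type*} [AddCommGroup V] [Module ℝ V] (f : ι → V →ᵃ[ℝ] ℝ) (x : V) : Set ι :=
  {i | f i x = 0}

theorem affineDim_mono {V : Type*} [NormedAddCommGroup V] [NormedSpace ℝ V]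
    [FiniteDimensional ℝ V] {F P : Set V} (h : F ⊆ P) : affineDim F ≤ affineDim P :=
  Submodule.finrank_mono (vectorSpan_mono ℝ h)

theorem convex_polyhedron {ι V : Type*} [AddCommGroup V] [Module ℝ V] (f : ι → V →ᵃ[ℝ] ℝ) :
    Convex ℝ (polyhedron f) := by
  intro x hx y hy a b ha hb hab i
  rw [Convex.combo_affine_apply hab]
  exact add_nonneg (mul_nonneg ha (hx i)) (mul_nonneg hb (hy i))

section Faces

variable {ι V : Type*} [Finite ι] [NormedAddCommGroup V] [NormedSpace ℝ V] [FiniteDimensional ℝ V]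
  {f : ι → V →ᵃ[ℝ] ℝ}

theorem AffineMap.continuous_real (g : V →ᵃ[ℝ] ℝ) : Continuous g :=
  g.continuous_of_finiteDimensional

theorem eventually_activeSet_subset (x : V) : ∀ᶠ y in nhds x, activeSet f y ⊆ activeSet f x := by
  have : ∀ᶠ y in nhds x, ∀ i, f i x ≠ 0 → f i y ≠ 0 := by
    rw [Filter.eventually_all]
    intro i
    by_cases h : f i x = 0
    · exact Filter.Eventually.of_forall fun _ h' => absurd h h'
    · filter_upwards [(f i).continuous_real.continuousAt.eventually_ne h] with y hy _ using hy
  filter_upwards [this] with y hy i hi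
  by_contra h
  exact hy i h hi

theorem isFace_setOf_activeSet_subset {p : V} (hp : p ∈ polyhedron f) :
    IsFace (polyhedron f) {x ∈ polyhedron f | activeSet f p ⊆ activeSet f x} := by
  classical
  have := Fintype.ofFinite ι
  refine ⟨⟨p, hp, subset_rfl⟩, fun _ => ?_⟩
  -- The face is exposed by the sum of the inequalities active at `p`.
  let L : V →ₗ[ℝ] ℝ := -∑ i with f i p = 0, (f i).linear
  have hL : ∀ x, L x - L p = -∑ i with f i p = 0, f i x := by
    intro x
    simp only [L, LinearMap.neg_apply, LinearMap.sum_apply]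
    rw [neg_sub_neg, ← neg_sub, ← Finset.sum_sub_distrib]
    congr 1
    refine Finset.sum_congr rfl fun i hi => ?_
    have h2 : f i ((x - p) +ᵥ p) = (f i).linear (x - p) +ᵥ f i p := (f i).map_vadd _ _
    rw [(Finset.mem_filter.1 hi).2] at h2
    simpa using h2.symm
  refine ⟨LinearMap.toContinuousLinearMap L, ?_⟩
  ext x
  simp only [LinearMap.coe_toContinuousLinearMap']
  refine ⟨fun hx => ⟨hx.1, fun y hy => ?_⟩, fun hx => ⟨hx.1, fun i hi => ?_⟩⟩
  · have h1 : 0 ≤ ∑ i with f i p = 0, f i y := Finset.sum_nonneg fun i _ => hy i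
    have h2 : ∑ i with f i p = 0, f i x = 0 :=
      Finset.sum_eq_zero fun i hi => hx.2 (Finset.mem_filter.1 hi).2
    have := hL x
    have := hL y
    linarith
  · have h1 : 0 ≤ ∑ i with f i p = 0, f i x := Finset.sum_nonneg fun i _ => hx.1 i
    have h2 := hx.2 p hp
    have h3 := hL x
    have h4 : ∑ i with f i p = 0, f i x = 0 := by linarith
    exact (Finset.sum_eq_zero_iff_of_nonneg fun i _ => hx.1 i).1 h4 i
      (Finset.mem_filter.2 ⟨Finset.mem_univ i, hi⟩)

theorem mem_intrinsicInterior_setOf_activeSet_subset {p : V} (hp : p ∈ polyhedron f) :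
    p ∈ intrinsicInterior ℝ {x ∈ polyhedron f | activeSet f p ⊆ activeSet f x} := by
  set F := {x ∈ polyhedron f | activeSet f p ⊆ activeSet f x} with hF
  have hpF : p ∈ F := ⟨hp, subset_rfl⟩
  have hspan : ∀ y ∈ affineSpan ℝ F, activeSet f p ⊆ activeSet f y := by
    intro y hy i hi
    refine affineSpan_induction (p := fun y => f i y = 0) hy (fun x hx => hx.2 hi) ?_
    intro c u v w hu hv hw
    have h1 : f i (c • (u -ᵥ v) +ᵥ w) = (f i).linear (c • (u -ᵥ v)) +ᵥ f i w :=
      (f i).map_vadd _ _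
    rw [h1, map_smul, (f i).linearMap_vsub, hu, hv, hw]
    simp
  refine ⟨⟨p, subset_affineSpan ℝ F hpF⟩, mem_interior_iff_mem_nhds.2 ?_, rfl⟩
  have hev : ∀ᶠ y in nhds p, ∀ i, f i p ≠ 0 → 0 < f i y := by
    rw [Filter.eventually_all]
    intro i
    by_cases h : f i p = 0
    · exact Filter.Eventually.of_forall fun _ h' => absurd h h'
    · filter_upwards [(f i).continuous_real.continuousAt.eventually_const_lt
        (lt_of_le_of_ne (hp i) (Ne.symm h))] with y hy _ using hy
  filter_upwards [continuous_subtype_val.continuousAt.eventually hev] with y hy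
  refine ⟨fun i => ?_, hspan y y.2⟩
  by_cases h : f i p = 0
  · exact (hspan y y.2 h).ge
  · exact (hy i h).le

/-- Every face containing `p` contains the smallest face containing `p`. -/
theorem IsFace.mem_of_activeSet_subset {F : Set V} (hF : IsFace (polyhedron f) F) {p x : V}
    (hp : p ∈ F) (hx : x ∈ polyhedron f) (hpx : activeSet f p ⊆ activeSet f x) : x ∈ F := by
  obtain ⟨l, hl⟩ := hF.2 hF.1
  have hpP : p ∈ polyhedron f := hF.2.subset hp
  -- The segment from `x` to `p` can be prolonged beyond `p` inside the polyhedron.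
  have hev : ∀ᶠ s in nhdsWithin (1 : ℝ) (Set.Ioi 1), ∀ i, 0 ≤ f i (x + s • (p - x)) := by
    rw [Filter.eventually_all]
    intro i
    by_cases h : f i p = 0
    · have hx0 : f i x = 0 := hpx h
      exact Filter.Eventually.of_forall fun s => by
        rw [AffineMap.apply_add_smul_sub, h, hx0]; simp
    · have hc : ContinuousAt (fun s : ℝ => f i (x + s • (p - x))) 1 :=
        ((f i).continuous_real.comp (by fun_prop)).continuousAt
      have h1 : 0 < f i (x + (1 : ℝ) • (p - x)) := by
        simpa using lt_of_le_of_ne (hpP i) (Ne.symm h)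
      filter_upwards [nhdsWithin_le_nhds (hc.eventually_const_lt h1)] with s hs using hs.le
  obtain ⟨s, hs, hs1⟩ := (hev.and self_mem_nhdsWithin).exists
  have hs1 : 1 < s := hs1
  rw [hl] at hp ⊢
  have h1 := hp.2 _ hs
  simp only [map_add, map_smul, map_sub, smul_eq_mul] at h1
  refine ⟨hx, fun y hy => (hp.2 y hy).trans ?_⟩
  nlinarith

end Faces

/-! ### Pushing two distinct points of a polytope into disjoint faces -/

section Closure

variable {ι V : Type*} [AddCommGroup V] [Module ℝ V]

/-- The inequalities that are equalities on the whole face where those in `S` are equalities. If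
this face is empty, these are all inequalities. -/
def activeClosure (f : ι → V →ᵃ[ℝ] ℝ) (S : Set ι) : Set ι :=
  {i | ∀ y ∈ polyhedron f, S ⊆ activeSet f y → i ∈ activeSet f y}

variable {f : ι → V →ᵃ[ℝ] ℝ}

theorem subset_activeClosure (S : Set ι) : S ⊆ activeClosure f S :=
  fun _ hi _ _ hS => hS hi

theorem activeClosure_mono {S T : Set ι} (h : S ⊆ T) : activeClosure f S ⊆ activeClosure f T :=
  fun _ hi y hy hT => hi y hy (h.trans hT)

/-- Every nonempty face has a point in its relative interior. -/
theorem exists_activeSet_eq_activeClosure [Finite ι] {S : Set ι}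
    (hS : ∃ y ∈ polyhedron f, S ⊆ activeSet f y) :
    ∃ c ∈ polyhedron f, activeSet f c = activeClosure f S := by
  have key : ∀ T : Set ι, (∀ i ∈ T, i ∉ activeClosure f S) →
      ∃ c ∈ polyhedron f, S ⊆ activeSet f c ∧ ∀ i ∈ T, f i c ≠ 0 := by
    intro T
    induction T, T.toFinite using Set.Finite.induction_on with
    | empty => exact fun _ => let ⟨y, hy, hyS⟩ := hS; ⟨y, hy, hyS, by simp⟩
    | @insert i T _ _ ih =>
      intro hT
      obtain ⟨c, hc, hcS, hcT⟩ := ih fun j hj => hT j (Or.inr hj)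
      have hi := hT i (Or.inl rfl)
      simp only [activeClosure, Set.mem_ofPred_eq, not_forall] at hi
      obtain ⟨y, hy, hyS, hyi⟩ := hi
      have hval : ∀ j, f j (c + (1 / 2 : ℝ) • (y - c)) = (f j c + f j y) / 2 := fun j => by
        rw [AffineMap.apply_add_smul_sub]; ring
      refine ⟨c + (1 / 2 : ℝ) • (y - c), fun j => ?_, fun j hj => ?_, ?_⟩
      · rw [hval]; linarith [hc j, hy j]
      · change f j _ = 0
        rw [hval, show f j c = 0 from hcS hj, show f j y = 0 from hyS hj]; simp
      · rintro j (rfl | hj) <;> rw [hval]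
        · have := lt_of_le_of_ne (hy j) (Ne.symm hyi)
          linarith [hc j]
        · have := lt_of_le_of_ne (hc j) (Ne.symm (hcT j hj))
          linarith [hy j]
  obtain ⟨c, hc, hcS, hcT⟩ := key (activeClosure f S)ᶜ fun _ hi => hi
  refine ⟨c, hc, Set.Subset.antisymm (fun i hi => ?_) fun i hi => hi c hc hcS⟩
  by_contra h
  exact hcT i h hi

end Closure

section ExitRate

open scoped NNReal

variable {ι V : Type*} [Fintype ι] [NormedAddCommGroup V] [NormedSpace ℝ V]

/-- The inverse of the time at which the ray `c + s • (p - c)` from a point `c` of the polyhedron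
leaves it through an inequality that is strict at `c`. Division by zero makes the inequalities that
are equalities at `c` contribute `0`. -/
noncomputable def exitRate (f : ι → V →ᵃ[ℝ] ℝ) (c p : V) : ℝ≥0 :=
  Finset.univ.sup fun i => ((f i c - f i p) / f i c).toNNReal

variable {f : ι → V →ᵃ[ℝ] ℝ} {c p : V}

theorem continuous_exitRate [FiniteDimensional ℝ V] (f : ι → V →ᵃ[ℝ] ℝ) (c : V) :
    Continuous (exitRate f c) := by
  have h : ∀ i, Continuous (f i) := fun i => (f i).continuous_real
  unfold exitRate
  refine Continuous.finset_sup_apply (s := Finset.univ)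
    (f := fun i p => ((f i c - f i p) / f i c).toNNReal) fun i _ => ?_
  exact continuous_real_toNNReal.comp ((continuous_const.sub (h i)).div_const _)

theorem div_le_exitRate (i : ι) : (f i c - f i p) / f i c ≤ exitRate f c p :=
  (Real.le_coe_toNNReal _).trans <| NNReal.coe_le_coe.2 <|
    Finset.le_sup (f := fun i => ((f i c - f i p) / f i c).toNNReal) (Finset.mem_univ i)

theorem exitRate_le_one (hc : c ∈ polyhedron f) (hp : p ∈ polyhedron f) : exitRate f c p ≤ 1 := by
  refine Finset.sup_le fun i _ => Real.toNNReal_le_one.2 ?_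
  exact div_le_one_of_le₀ (by linarith [hp i]) (hc i)

theorem add_smul_sub_mem_polyhedron (hc : c ∈ polyhedron f) (hp : p ∈ polyhedron f) {s : ℝ}
    (hs : 0 ≤ s) (h : s * exitRate f c p ≤ 1) : c + s • (p - c) ∈ polyhedron f := by
  intro i
  rw [AffineMap.apply_add_smul_sub]
  rcases (hc i).eq_or_lt with h0 | h0
  · rw [← h0]
    have := mul_nonneg hs (hp i)
    linarith
  · have h1 := (mul_le_mul_of_nonneg_left (div_le_exitRate (f := f) (c := c) (p := p) i) hs).trans h
    rw [mul_div_assoc', div_le_one h0] at h1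
    linarith

theorem eq_of_exitRate_eq_zero (hb : Bornology.IsBounded (polyhedron f)) (hc : c ∈ polyhedron f)
    (hp : p ∈ polyhedron f) (h : exitRate f c p = 0) : p = c :=
  hb.eq_of_forall_add_smul_mem fun s hs => add_smul_sub_mem_polyhedron hc hp hs (by simp [h])

theorem exists_mem_activeSet_of_mul_exitRate_eq_one {s : ℝ} (h : s * exitRate f c p = 1) :
    ∃ i, i ∉ activeSet f c ∧ i ∈ activeSet f (c + s • (p - c)) := by
  have hne : exitRate f c p ≠ 0 := by
    intro h0
    simp [h0] at h
  have huniv : (Finset.univ : Finset ι).Nonempty := by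
    rw [Finset.nonempty_iff_ne_empty]
    intro h0
    exact hne (by simp [exitRate, h0])
  obtain ⟨i, -, hi⟩ := Finset.exists_mem_eq_sup Finset.univ huniv
    fun i => ((f i c - f i p) / f i c).toNNReal
  change exitRate f c p = _ at hi
  have hpos : 0 < (f i c - f i p) / f i c := by
    rw [← Real.toNNReal_pos, ← hi]
    exact pos_of_ne_zero hne
  have hci : f i c ≠ 0 := by
    intro h0
    simp [h0] at hpos
  refine ⟨i, hci, ?_⟩
  change f i _ = 0
  rw [hi, Real.coe_toNNReal _ hpos.le] at h
  rw [AffineMap.apply_add_smul_sub]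
  field_simp at h
  linarith

theorem exitRate_eq_one (hc : c ∈ polyhedron f) (hp : p ∈ polyhedron f) {i : ι}
    (hic : i ∉ activeSet f c) (hip : i ∈ activeSet f p) : exitRate f c p = 1 := by
  refine le_antisymm (exitRate_le_one hc hp) ?_
  have h := div_le_exitRate (f := f) (c := c) (p := p) i
  rw [show f i p = 0 from hip, sub_zero, div_self hic] at h
  exact_mod_cast h

end ExitRate

section Pairs

variable {ι V : Type*} [NormedAddCommGroup V] [NormedSpace ℝ V]

/-- The pairs of distinct points of a set. -/
abbrev DistinctPairs (P : Set V) : Type _ := {x : V × V // x.1 ∈ P ∧ x.2 ∈ P ∧ x.1 ≠ x.2}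

variable (f : ι → V →ᵃ[ℝ] ℝ)

/-- The pair `y` lies, coordinatewise, in the smallest faces containing the pair `x`. -/
def FaceLE (x y : DistinctPairs (polyhedron f)) : Prop :=
  activeSet f x.1.1 ⊆ activeSet f y.1.1 ∧ activeSet f x.1.2 ⊆ activeSet f y.1.2

/-- The inequalities that are equalities on the intersection of the smallest faces containing the
two points of the pair `x`. -/
def pairClosure (x : DistinctPairs (polyhedron f)) : Set ι :=
  activeClosure f (activeSet f x.1.1 ∪ activeSet f x.1.2)

variable {f}

theorem FaceLE.pairClosure_subset {x y : DistinctPairs (polyhedron f)} (h : FaceLE f x y) :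
    pairClosure f x ⊆ pairClosure f y :=
  activeClosure_mono (Set.union_subset_union h.1 h.2)

end Pairs

section Retraction

open unitInterval

/-- `A` is a strong deformation retract of `B`, by a homotopy along which points only move to
points related to them by `R`. -/
def IsDeformationRetractAlong {B : Type*} [TopologicalSpace B] (R : B → B → Prop) (A : Set B) :
    Prop :=
  ∃ h : C(B × I, B), (∀ x, h (x, 0) = x) ∧ (∀ x, h (x, 1) ∈ A) ∧ (∀ x ∈ A, ∀ t, h (x, t) = x) ∧
    ∀ x t, R x (h (x, t))

/-- A strong deformation retraction onto `A`, followed by one of `A` (inside `B`) onto `A'`. -/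
theorem IsDeformationRetractAlong.trans {B : Type*} [TopologicalSpace B] {R : B → B → Prop}
    (hR : ∀ x y z, R x y → R y z → R x z) {A A' : Set B} (hA : IsDeformationRetractAlong R A)
    (hA' : A' ⊆ A) (g : C(A × I, B)) (g0 : ∀ x : A, g (x, 0) = x) (g1 : ∀ x : A, g (x, 1) ∈ A')
    (gA : ∀ x : A, (x : B) ∈ A' → ∀ t, g (x, t) = x) (gR : ∀ (x : A) t, R x (g (x, t))) :
    IsDeformationRetractAlong R A' := by
  obtain ⟨h, h0, h1, hfix, hR'⟩ := hA
  let u : I → I := fun t => Set.projIcc 0 1 zero_le_one (2 * (t : ℝ))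
  let v : I → I := fun t => Set.projIcc 0 1 zero_le_one (2 * (t : ℝ) - 1)
  have hu : Continuous u := continuous_projIcc.comp (by fun_prop)
  have hv : Continuous v := continuous_projIcc.comp (by fun_prop)
  have hu0 : u 0 = 0 := by simp [u]
  have hv1 : v 1 = 1 := by
    simp only [v]
    norm_num
  let k : B × I → B := fun z => g (⟨h (z.1, 1), h1 z.1⟩, v z.2)
  have hk : Continuous k := by fun_prop
  refine ⟨⟨fun z => if (z.2 : ℝ) ≤ 1 / 2 then h (z.1, u z.2) else k z, ?_⟩, ?_, ?_, ?_, ?_⟩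
  · refine Continuous.if_le (by fun_prop) hk (by fun_prop) continuous_const ?_
    rintro ⟨x, t⟩ ht
    dsimp only at ht
    have hu1 : u t = 1 := by simp [u, ht]
    have hv0 : v t = 0 := by simp [v, ht]
    simp only [k, hu1, hv0, g0]
  · intro x
    simp [hu0, h0]
  · intro x
    have : ¬ ((1 : ℝ) ≤ 1 / 2) := by norm_num
    simp only [ContinuousMap.coe_mk, Set.Icc.coe_one, this, if_false, k, hv1, g1]
  · intro x hx t
    simp only [ContinuousMap.coe_mk, k]
    split_ifs
    · exact hfix x (hA' hx) _
    · have : (⟨h (x, 1), h1 x⟩ : A) = ⟨x, hA' hx⟩ := Subtype.ext (hfix x (hA' hx) 1)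
      rw [this]
      exact gA _ hx _
  · intro x t
    simp only [ContinuousMap.coe_mk, k]
    split_ifs
    · exact hR' _ _
    · exact hR _ _ _ (hR' x 1) (gR ⟨h (x, 1), h1 x⟩ _)

variable {ι V : Type*} [Fintype ι] [NormedAddCommGroup V] [NormedSpace ℝ V] [FiniteDimensional ℝ V]

variable {f : ι → V →ᵃ[ℝ] ℝ}

theorem isClosed_setOf_pairClosure {Q : Set ι → Prop} (hQ : ∀ S T, S ⊆ T → Q S → Q T) :
    IsClosed {x : DistinctPairs (polyhedron f) | Q (pairClosure f x)} := by
  rw [← isOpen_compl_iff, isOpen_iff_eventually]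
  intro x hx
  have h1 : ∀ᶠ y : DistinctPairs (polyhedron f) in nhds x, activeSet f y.1.1 ⊆ activeSet f x.1.1 :=
    (show Continuous fun y : DistinctPairs (polyhedron f) => y.1.1 by fun_prop).continuousAt.eventually
      (eventually_activeSet_subset x.1.1)
  have h2 : ∀ᶠ y : DistinctPairs (polyhedron f) in nhds x, activeSet f y.1.2 ⊆ activeSet f x.1.2 :=
    (show Continuous fun y : DistinctPairs (polyhedron f) => y.1.2 by fun_prop).continuousAt.eventually
      (eventually_activeSet_subset x.1.2)
  filter_upwards [h1, h2] with y hy1 hy2 hQy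
  exact hx (hQ _ _ (FaceLE.pairClosure_subset ⟨hy1, hy2⟩) hQy)

/-- One step of the retraction: if `J` is maximal in the family `𝒟`, the pairs whose closure is
`J` are pushed radially away from `(c, c)`, where `c` is a point of the relative interior of the
face of `J`, until an inequality outside `J` becomes an equality. -/
theorem IsDeformationRetractAlong.pairClosure_step (hb : Bornology.IsBounded (polyhedron f))
    {𝒟 : Set (Set ι)} {J : Set ι} (hJ : Maximal (· ∈ 𝒟) J) (hlow : IsLowerSet 𝒟)
    {c : V} (hc : c ∈ polyhedron f) (hcJ : activeSet f c = J)
    (h : IsDeformationRetractAlong (FaceLE f) {x | pairClosure f x ∉ 𝒟 \ {J}}) :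
    IsDeformationRetractAlong (FaceLE f) {x | pairClosure f x ∉ 𝒟} := by
  classical
  set A : Set (DistinctPairs (polyhedron f)) := {x | pairClosure f x ∉ 𝒟 \ {J}} with hA
  let κ : DistinctPairs (polyhedron f) → ℝ := fun x =>
    ((exitRate f c x.1.1 ⊔ exitRate f c x.1.2 : NNReal) : ℝ)
  have hκ : Continuous κ := by
    have := continuous_exitRate f c
    fun_prop
  have hκ1 : ∀ x, κ x ≤ 1 := fun x => by
    have := sup_le (exitRate_le_one hc x.2.1) (exitRate_le_one hc x.2.2.1)
    exact_mod_cast this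
  have hκpos : ∀ x, 0 < κ x := fun x => by
    refine NNReal.coe_pos.2 (pos_of_ne_zero fun h0 => x.2.2.2 ?_)
    obtain ⟨h1, h2⟩ := max_eq_zero.1 h0
    rw [eq_of_exitRate_eq_zero hb hc x.2.1 h1, eq_of_exitRate_eq_zero hb hc x.2.2.1 h2]
  let s : DistinctPairs (polyhedron f) × I → ℝ := fun z => (1 - (z.2 : ℝ)) + z.2 * (κ z.1)⁻¹
  have hs : Continuous s := by
    have h1 : Continuous fun z : DistinctPairs (polyhedron f) × I => (κ z.1)⁻¹ :=
      (hκ.inv₀ fun x => (hκpos x).ne').comp continuous_fst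
    exact (continuous_const.sub (by fun_prop)).add (Continuous.mul (by fun_prop) h1)
  have hsκ : ∀ z, s z * κ z.1 ≤ 1 := fun z => by
    have : s z * κ z.1 = (1 - (z.2 : ℝ)) * κ z.1 + z.2 := by
      have := (hκpos z.1).ne'
      simp only [s]
      field_simp
    rw [this]
    nlinarith [hκ1 z.1, z.2.2.2]
  have hs1 : ∀ z, 1 ≤ s z := fun z => by
    have h1 : 1 ≤ (κ z.1)⁻¹ := (one_le_inv₀ (hκpos _)).2 (hκ1 _)
    have h2 := mul_le_mul_of_nonneg_left h1 z.2.2.1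
    simp only [s]
    linarith
  let ρ : DistinctPairs (polyhedron f) × I → DistinctPairs (polyhedron f) := fun z =>
    ⟨(c + s z • (z.1.1.1 - c), c + s z • (z.1.1.2 - c)),
      add_smul_sub_mem_polyhedron hc z.1.2.1 (by linarith [hs1 z])
        ((mul_le_mul_of_nonneg_left (NNReal.coe_le_coe.2 le_sup_left)
          (by linarith [hs1 z])).trans (hsκ z)),
      add_smul_sub_mem_polyhedron hc z.1.2.2.1 (by linarith [hs1 z])
        ((mul_le_mul_of_nonneg_left (NNReal.coe_le_coe.2 le_sup_right)
          (by linarith [hs1 z])).trans (hsκ z)),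
      fun heq => z.1.2.2.2 (by
        have := smul_right_injective V (show s z ≠ 0 by linarith [hs1 z]) (add_left_cancel heq)
        simpa using this)⟩
  have hρ : Continuous ρ := by
    refine Continuous.subtype_mk (by fun_prop) _
  -- A pair with an equality outside `J` stays where it is.
  have hρfix : ∀ x t, J ⊆ pairClosure f x → pairClosure f x ≠ J → ρ (x, t) = x := by
    intro x t hJx hne
    obtain ⟨i, hi, hiJ⟩ : ∃ i ∈ activeSet f x.1.1 ∪ activeSet f x.1.2, i ∉ J := by
      by_contra! hcon
      refine hne (Set.Subset.antisymm (fun i hi => ?_) hJx)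
      rw [← hcJ] at hcon ⊢
      exact hi c hc hcon
    have hκx : κ x = 1 := by
      refine le_antisymm (hκ1 x) ?_
      rw [← hcJ] at hiJ
      rcases hi with hi | hi
      · have := exitRate_eq_one hc x.2.1 hiJ hi
        simp [κ, ← this]
      · have := exitRate_eq_one hc x.2.2.1 hiJ hi
        simp [κ, ← this]
    simp [ρ, s, hκx]
  have hρR : ∀ x t, pairClosure f x = J → FaceLE f x (ρ (x, t)) := by
    intro x t hx
    have hsub : activeSet f x.1.1 ∪ activeSet f x.1.2 ⊆ activeSet f c := by
      rw [hcJ, ← hx]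
      exact subset_activeClosure _
    refine ⟨fun i hi => ?_, fun i hi => ?_⟩
    · change f i _ = 0
      rw [AffineMap.apply_add_smul_sub, show f i c = 0 from hsub (Or.inl hi),
        show f i x.1.1 = 0 from hi]
      simp
    · change f i _ = 0
      rw [AffineMap.apply_add_smul_sub, show f i c = 0 from hsub (Or.inr hi),
        show f i x.1.2 = 0 from hi]
      simp
  have hρ1 : ∀ x, pairClosure f x = J → pairClosure f (ρ (x, 1)) ∉ 𝒟 := by
    intro x hx hmem
    have hle := (hρR x 1 hx).pairClosure_subset
    rw [hx] at hle
    have heq := hJ.eq_of_subset hmem hle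
    have hsx : s (x, 1) * κ x = 1 := by
      simp [s, (hκpos x).ne']
    obtain ⟨i, hic, hi⟩ : ∃ i, i ∉ activeSet f c ∧
        i ∈ activeSet f (ρ (x, 1)).1.1 ∪ activeSet f (ρ (x, 1)).1.2 := by
      rcases le_total (exitRate f c x.1.1) (exitRate f c x.1.2) with hle | hle
      · simp only [κ, sup_of_le_right hle] at hsx
        obtain ⟨i, hi, hi'⟩ := exists_mem_activeSet_of_mul_exitRate_eq_one hsx
        exact ⟨i, hi, Or.inr hi'⟩
      · simp only [κ, sup_of_le_left hle] at hsx
        obtain ⟨i, hi, hi'⟩ := exists_mem_activeSet_of_mul_exitRate_eq_one hsx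
        exact ⟨i, hi, Or.inl hi'⟩
    rw [hcJ, heq] at hic
    exact hic (subset_activeClosure _ hi)
  let G : A × I → DistinctPairs (polyhedron f) := fun z =>
    if pairClosure f z.1.1 = J then ρ (z.1.1, z.2) else z.1.1
  have hGJ : ∀ z : A × I, J ⊆ pairClosure f z.1.1 → G z = ρ (z.1.1, z.2) := by
    intro z hz
    by_cases hzJ : pairClosure f z.1.1 = J
    · simp [G, hzJ]
    · simp [G, hzJ, hρfix _ _ hz hzJ]
  have hG : Continuous G := by
    let Z : Set (A × I) := {z | J ⊆ pairClosure f z.1.1}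
    let W : Set (A × I) := {z | pairClosure f z.1.1 ∉ 𝒟}
    have hZ : IsClosed Z :=
      (isClosed_setOf_pairClosure (Q := fun S => J ⊆ S) fun S T h h' => h'.trans h).preimage
        (show Continuous fun z : A × I => z.1.1 by fun_prop)
    have hW : IsClosed W :=
      (isClosed_setOf_pairClosure (Q := fun S => S ∉ 𝒟) fun S T h h' hT => h' (hlow h hT)).preimage
        (show Continuous fun z : A × I => z.1.1 by fun_prop)
    have hZW : Z ∪ W = Set.univ := by
      refine Set.eq_univ_of_forall fun z => ?_
      by_cases hz : pairClosure f z.1.1 = J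
      · exact Or.inl hz.ge
      · exact Or.inr fun hD => z.1.2 ⟨hD, hz⟩
    rw [← continuousOn_univ, ← hZW]
    refine ContinuousOn.union_of_isClosed ?_ ?_ hZ hW
    · refine ContinuousOn.congr (f := fun z : A × I => ρ (z.1.1, z.2)) ?_ hGJ
      exact (hρ.comp (by fun_prop)).continuousOn
    · refine ContinuousOn.congr (f := fun z : A × I => z.1.1) ?_ fun z hz => ?_
      · exact (show Continuous fun z : A × I => z.1.1 by fun_prop).continuousOn
      · have : pairClosure f z.1.1 ≠ J := fun h => hz (h ▸ hJ.prop)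
        simp [G, this]
  refine h.trans (fun x y z h1 h2 => ⟨h1.1.trans h2.1, h1.2.trans h2.2⟩)
    (fun x hx hx' => hx hx'.1) ⟨G, hG⟩ (fun x => ?_) (fun x => ?_) (fun x hx t => ?_)
    fun x t => ?_
  · change G (x, 0) = x
    by_cases hx : pairClosure f x.1 = J
    · simp [G, hx, ρ, s]
    · simp [G, hx]
  · change pairClosure f (G (x, 1)) ∉ 𝒟
    by_cases hx : pairClosure f x.1 = J
    · simpa [G, hx] using hρ1 x hx
    · simp only [G, hx, if_false]
      exact fun hD => x.2 ⟨hD, hx⟩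
  · have : pairClosure f x.1 ≠ J := fun h => hx (h ▸ hJ.prop)
    simp [G, this]
  · change FaceLE f x (G (x, t))
    by_cases hx : pairClosure f x.1 = J
    · simpa [G, hx] using hρR x t hx
    · simp only [G, hx, if_false]
      exact ⟨subset_rfl, subset_rfl⟩

theorem isDeformationRetractAlong_pairClosure (hb : Bornology.IsBounded (polyhedron f))
    {𝒟 : Set (Set ι)} (hlow : IsLowerSet 𝒟) (huniv : Set.univ ∉ 𝒟) :
    IsDeformationRetractAlong (FaceLE f) {x | pairClosure f x ∉ 𝒟} := by
  induction hn : 𝒟.ncard generalizing 𝒟 with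
  | zero =>
    rw [Set.ncard_eq_zero] at hn
    refine ⟨⟨Prod.fst, continuous_fst⟩, fun _ => rfl, fun _ => ?_, fun _ _ _ => rfl,
      fun _ _ => ⟨subset_rfl, subset_rfl⟩⟩
    simp [hn]
  | succ n ih =>
    obtain ⟨J, hJ⟩ : ∃ J, Maximal (· ∈ 𝒟) J :=
      (Set.toFinite 𝒟).exists_maximal ((Set.ncard_pos).1 (by omega))
    have hlow' : IsLowerSet (𝒟 \ {J}) := fun S T hTS hS =>
      ⟨hlow hTS hS.1, fun hT => hS.2 (hJ.eq_of_subset hS.1 ((show T = J from hT) ▸ hTS)).symm⟩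
    have h := ih hlow' (fun hm => huniv hm.1)
      (by rw [Set.ncard_sdiff_singleton_of_mem hJ.prop]; omega)
    by_cases hx : ∃ x : DistinctPairs (polyhedron f), pairClosure f x = J
    · obtain ⟨x, hx⟩ := hx
      -- The face of `J` is nonempty, as otherwise `J` would contain all inequalities.
      obtain ⟨c, hc, hcJ⟩ := exists_activeSet_eq_activeClosure (f := f)
        (S := activeSet f x.1.1 ∪ activeSet f x.1.2) (by
          by_contra! hcon
          refine huniv ?_
          rw [show Set.univ = J from ?_]
          · exact hJ.prop
          · rw [← hx]
            exact (Set.eq_univ_of_forall fun i y hy hS => absurd hS (hcon y hy)).symm)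
      exact h.pairClosure_step hb hJ hlow hc (hcJ.trans hx)
    · have : {x | pairClosure f x ∉ 𝒟} = {x | pairClosure f x ∉ 𝒟 \ {J}} := by
        ext x
        simp only [Set.mem_ofPred_eq, Set.mem_sdiff, Set.mem_singleton_iff, not_and, not_not]
        exact ⟨fun h1 h2 => absurd h2 h1, fun h1 h2 => hx ⟨x, h1 h2⟩⟩
      rwa [this]

/-- Pairs of distinct points of a polytope retract onto the pairs lying in disjoint faces, and
while moving each point stays in its smallest face. -/
theorem exists_retraction_onto_disjoint_faces (hb : Bornology.IsBounded (polyhedron f)) :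
    IsDeformationRetractAlong (FaceLE f) {x : DistinctPairs (polyhedron f) |
      ∀ y ∈ polyhedron f,
        activeSet f x.1.1 ⊆ activeSet f y → ¬ activeSet f x.1.2 ⊆ activeSet f y} := by
  convert isDeformationRetractAlong_pairClosure hb (𝒟 := {S | S ≠ Set.univ})
    (fun S T hTS hS hT => hS (Set.univ_subset_iff.1 (hT ▸ hTS))) (by simp) using 1
  ext x
  simp only [Set.mem_ofPred_eq, not_not]
  refine ⟨fun h => Set.eq_univ_of_forall fun i y hy hS => ?_, fun h y hy h1 h2 => x.2.2.2 ?_⟩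
  · exact absurd (Set.subset_union_right.trans hS) (h y hy (Set.subset_union_left.trans hS))
  · -- If all inequalities are equalities at `y`, the polytope is the point `y`.
    have hy0 : ∀ i, f i y = 0 := fun i =>
      (h ▸ Set.mem_univ i : i ∈ pairClosure f x) y hy (Set.union_subset h1 h2)
    have key : ∀ p ∈ polyhedron f, p = y := fun p hp =>
      hb.eq_of_forall_add_smul_mem (y := y) fun s hs i => by
        rw [AffineMap.apply_add_smul_sub, hy0]
        simpa using mul_nonneg hs (hp i)
    rw [key _ x.2.1, key _ x.2.2.1]

end Retraction

/-! ### Standard charts -/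

/-- In the chart `e`, the action of `G_d^n` is the standard representation up to the
automorphism `φ`. -/
def IsStandardChart {𝕜 : Type*} [RCLike 𝕜] {n : ℕ} {M : Type*} [TopologicalSpace M]
    [MulAction (Gd 𝕜 n) M] (e : OpenPartialHomeomorph M (Fin n → 𝕜)) (φ : Gd 𝕜 n ≃ₜ* Gd 𝕜 n) :
    Prop :=
  ∀ g : Gd 𝕜 n, ∀ y ∈ e.source, g • y ∈ e.source ∧ e (g • y) = stdRep (φ g) (e y)

section TwoTorsion

theorem Nat.card_sphere_sq_eq_one (𝕜 : Type*) [RCLike 𝕜] :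
    Nat.card {s : Metric.sphere (0 : 𝕜) 1 // s ^ 2 = 1} = 2 := by
  rw [Nat.card_eq_two_iff]
  refine ⟨⟨1, one_pow 2⟩, ⟨-1, by simp⟩, ?_, ?_⟩
  · intro h
    have h1 : ((1 : Metric.sphere (0 : 𝕜) 1) : 𝕜) = ((-1 : Metric.sphere (0 : 𝕜) 1) : 𝕜) := by
      exact congrArg Subtype.val (Subtype.ext_iff.1 h)
    have h2 : (1 : 𝕜) = -1 := by simpa using h1
    have h3 : (2 : 𝕜) = 0 := by linear_combination h2
    exact two_ne_zero h3
  · refine Set.eq_univ_of_forall fun ⟨s, hs⟩ => ?_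
    have h1 : ((s ^ 2 : Metric.sphere (0 : 𝕜) 1) : 𝕜) = ((1 : Metric.sphere (0 : 𝕜) 1) : 𝕜) := by
      rw [hs]
    have h2 : (s : 𝕜) ^ 2 = 1 := by simpa using h1
    rcases sq_eq_one_iff.1 h2 with h | h
    · left
      ext
      simpa using h
    · right
      ext
      simpa using h

variable {𝕜 : Type*} [RCLike 𝕜] {n : ℕ} {M : Type*} [TopologicalSpace M] [MulAction (Gd 𝕜 n) M]
  {e : OpenPartialHomeomorph M (Fin n → 𝕜)} {φ : Gd 𝕜 n ≃ₜ* Gd 𝕜 n}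

theorem IsStandardChart.smul_eq_iff (he : IsStandardChart e φ) {x : M} (hx : x ∈ e.source)
    (g : Gd 𝕜 n) : g • x = x ↔ ∀ i, e x i ≠ 0 → φ g i = 1 := by
  rw [← e.injOn.eq_iff (he g x hx).1 hx, (he g x hx).2, funext_iff]
  refine forall_congr' fun i => ?_
  rw [stdRep]
  constructor
  · intro h hi
    ext
    simpa using mul_right_cancel₀ hi (h.trans (one_mul _).symm)
  · intro h
    by_cases hi : e x i = 0
    · simp [hi]
    · simp [h hi]

/-- The isotropy group of a point with `k` vanishing coordinates in a standard chart has `2 ^ k`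
elements of order dividing two, both for `𝕜 = ℝ` and for `𝕜 = ℂ`. -/
theorem IsStandardChart.card_stabilizer_sq_eq_one (he : IsStandardChart e φ) {x : M}
    (hx : x ∈ e.source) :
    Nat.card {g : MulAction.stabilizer (Gd 𝕜 n) x // g ^ 2 = 1} = 2 ^ {i | e x i = 0}.ncard := by
  classical
  have hpow := Nat.card_fun (α := {i | e x i = 0}) (β := {s : Metric.sphere (0 : 𝕜) 1 // s ^ 2 = 1})
  rw [Nat.card_sphere_sq_eq_one, Nat.card_coe_set_eq] at hpow
  rw [← hpow]
  refine Nat.card_congr ⟨fun g i => ⟨φ g.1.1 i.1, ?_⟩,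
    fun k => ⟨⟨φ.symm fun i => if hi : e x i = 0 then k ⟨i, hi⟩ else 1, ?_⟩, ?_⟩, ?_, ?_⟩
  · have h1 : (g.1.1 : Gd 𝕜 n) ^ 2 = 1 := by
      have := congrArg Subtype.val g.2
      simpa using this
    have h2 := congrFun (congrArg φ h1) i.1
    simpa using h2
  · rw [MulAction.mem_stabilizer_iff, he.smul_eq_iff hx]
    intro i hi
    simp [hi]
  · ext1
    change (φ.symm _) ^ 2 = 1
    rw [← map_pow, EmbeddingLike.map_eq_one_iff]
    funext i
    by_cases hi : e x i = 0
    · simpa [hi] using (k ⟨i, hi⟩).2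
    · simp [hi]
  · rintro ⟨⟨g, hg⟩, hg2⟩
    rw [MulAction.mem_stabilizer_iff, he.smul_eq_iff hx] at hg
    ext1
    ext1
    change φ.symm _ = g
    rw [ContinuousMulEquiv.symm_apply_eq]
    funext i
    by_cases hi : e x i = 0
    · simp [hi]
    · simp [hi, hg i hi]
  · intro k
    funext i
    have hi : e x i.1 = 0 := i.2
    ext1
    simp [hi]

end TwoTorsion

section SegmentPoint

variable {ι V : Type*} [NormedAddCommGroup V] [NormedSpace ℝ V] {f : ι → V →ᵃ[ℝ] ℝ}

/-- The point dividing the segment from `p` to `q` in a polyhedron in the ratio `t`, where `t` is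
first clamped to `[0, 1]`. -/
noncomputable def segmentPoint (p q : polyhedron f) (t : ℝ) : polyhedron f :=
  ⟨AffineMap.lineMap (p : V) (q : V) (Set.projIcc (0 : ℝ) 1 zero_le_one t : ℝ),
    (convex_polyhedron f).lineMap_mem p.2 q.2 (Set.projIcc (0 : ℝ) 1 zero_le_one t).2⟩

theorem coe_segmentPoint (p q : polyhedron f) {t : ℝ} (h0 : 0 ≤ t) (h1 : t ≤ 1) :
    (segmentPoint p q t : V) = AffineMap.lineMap (p : V) (q : V) t := by
  simp [segmentPoint, Set.projIcc_of_mem zero_le_one ⟨h0, h1⟩]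

theorem continuous_segmentPoint :
    Continuous fun z : (polyhedron f × polyhedron f) × ℝ => segmentPoint z.1.1 z.1.2 z.2 := by
  refine Continuous.subtype_mk ?_ _
  have : Continuous fun z : (polyhedron f × polyhedron f) × ℝ =>
      (Set.projIcc (0 : ℝ) 1 zero_le_one z.2 : ℝ) :=
    continuous_subtype_val.comp (continuous_projIcc.comp continuous_snd)
  simp only [AffineMap.lineMap_apply_module]
  fun_prop

@[simp]
theorem segmentPoint_zero (p q : polyhedron f) : segmentPoint p q 0 = p :=
  Subtype.ext (by simp [coe_segmentPoint])

@[simp]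
theorem segmentPoint_one (p q : polyhedron f) : segmentPoint p q 1 = q :=
  Subtype.ext (by simp [coe_segmentPoint])

@[simp]
theorem segmentPoint_self (p : polyhedron f) (t : ℝ) : segmentPoint p p t = p :=
  Subtype.ext (by simp [segmentPoint])

theorem activeSet_segmentPoint {p q : polyhedron f}
    (hpq : activeSet f (p : V) ⊆ activeSet f (q : V)) {t : ℝ} (h0 : 0 ≤ t) (h1 : t < 1) :
    activeSet f (segmentPoint p q t : V) = activeSet f (p : V) := by
  have hval : ∀ i, f i (segmentPoint p q t : V) = (1 - t) * f i p + t * f i q := fun i => by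
    rw [coe_segmentPoint p q h0 h1.le, AffineMap.apply_lineMap, AffineMap.lineMap_apply_module]
    simp
  ext i
  change f i _ = 0 ↔ f i _ = 0
  rw [hval]
  constructor
  · intro h
    have h2 := mul_nonneg h0 (q.2 i)
    have h3 := mul_nonneg (sub_nonneg.2 h1.le) (p.2 i)
    have h4 : (1 - t) * f i p = 0 := by linarith
    exact (mul_eq_zero.1 h4).resolve_left (by linarith)
  · intro h
    rw [h, show f i q = 0 from hpq h]
    simp

theorem activeSet_segmentPoint_subset {p q : polyhedron f}
    (hpq : activeSet f (p : V) ⊆ activeSet f (q : V)) {s t : ℝ} (h0 : 0 ≤ s) (hst : s ≤ t)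
    (h1 : t ≤ 1) :
    activeSet f (segmentPoint p q s : V) ⊆ activeSet f (segmentPoint p q t : V) := by
  rcases hst.eq_or_lt with rfl | hlt
  · exact subset_rfl
  rw [activeSet_segmentPoint hpq h0 (hlt.trans_le h1)]
  rcases h1.eq_or_lt with rfl | h1
  · rwa [segmentPoint_one]
  · rw [activeSet_segmentPoint hpq (h0.trans hst) h1]

theorem segmentPoint_segmentPoint (p q : polyhedron f) {a b t : ℝ} (ha : 0 ≤ a) (hab : a ≤ b)
    (hb : b ≤ 1) (ht0 : 0 ≤ t) (ht1 : t ≤ 1) :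
    segmentPoint (segmentPoint p q a) (segmentPoint p q b) t =
      segmentPoint p q (a + t * (b - a)) := by
  have h1 := mul_nonneg ht0 (sub_nonneg.2 hab)
  have h2 := mul_le_of_le_one_left (sub_nonneg.2 hab) ht1
  ext1
  rw [coe_segmentPoint _ _ ht0 ht1, coe_segmentPoint _ _ ha (hab.trans hb),
    coe_segmentPoint _ _ (ha.trans hab) hb, coe_segmentPoint _ _ (by linarith) (by linarith)]
  simp only [AffineMap.lineMap_apply_module]
  module

theorem dist_segmentPoint (p q : polyhedron f) {a b : ℝ} (ha0 : 0 ≤ a) (ha1 : a ≤ 1)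
    (hb0 : 0 ≤ b) (hb1 : b ≤ 1) :
    dist (segmentPoint p q a) (segmentPoint p q b) = |a - b| * dist p q := by
  rw [Subtype.dist_eq, coe_segmentPoint _ _ ha0 ha1, coe_segmentPoint _ _ hb0 hb1,
    dist_lineMap_lineMap, Real.dist_eq, Subtype.dist_eq]

end SegmentPoint

section OrbitMap

variable {𝕜 : Type*} [RCLike 𝕜] {n : ℕ} {M : Type*} [TopologicalSpace M]
  [ChartedSpace (Fin n → 𝕜) M] [MulAction (Gd 𝕜 n) M]
  {V : Type*} [NormedAddCommGroup V] [NormedSpace ℝ V] {P : Set V} {π : M → P}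

theorem IsGdManifoldOver.map_smul (hπ : IsGdManifoldOver 𝕜 n P π) (g : Gd 𝕜 n) (x : M) :
    π (g • x) = π x :=
  ((hπ.fibre_eq_orbit x (g • x)).2 ⟨g, rfl⟩).symm

theorem IsGdManifoldOver.exists_smul_eq (hπ : IsGdManifoldOver 𝕜 n P π) {x y : M}
    (h : π x = π y) : ∃ g : Gd 𝕜 n, g • x = y :=
  (hπ.fibre_eq_orbit x y).1 h

theorem IsGdManifoldOver.isOpenQuotientMap [CompactSpace M] [ContinuousSMul (Gd 𝕜 n) M]
    (hπ : IsGdManifoldOver 𝕜 n P π) : IsOpenQuotientMap π := by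
  refine ⟨hπ.surjective, hπ.continuous, fun W hW => ?_⟩
  have hq := hπ.continuous.isClosedMap.isQuotientMap hπ.continuous hπ.surjective
  rw [← hq.isOpen_preimage]
  have : π ⁻¹' (π '' W) = ⋃ g : Gd 𝕜 n, (fun x => g • x) ⁻¹' W := by
    ext y
    simp only [Set.mem_preimage, Set.mem_image, Set.mem_iUnion]
    constructor
    · rintro ⟨x, hx, hxy⟩
      obtain ⟨g, rfl⟩ := hπ.exists_smul_eq hxy.symm
      exact ⟨g, hx⟩
    · rintro ⟨g, hg⟩
      exact ⟨g • y, hg, hπ.map_smul g y⟩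
  rw [this]
  exact isOpen_iUnion fun g => hW.preimage (continuous_const_smul g)

/-- Each point of the polytope has a neighbourhood over which there is a standard chart. -/
theorem IsGdManifoldOver.exists_isStandardChart (hπ : IsGdManifoldOver 𝕜 n P π) (p : P) :
    ∃ e : OpenPartialHomeomorph M (Fin n → 𝕜), (∃ φ, IsStandardChart e φ) ∧ p ∈ π '' e.source := by
  obtain ⟨x, rfl⟩ := hπ.surjective p
  obtain ⟨e, -, φ, hx, h⟩ := hπ.locallyStandard x
  exact ⟨e, ⟨φ, h⟩, x, hx, rfl⟩

/-- The moduli of the coordinates, in the chart `e`, of the points over `p`. They depend only on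
`p` if `e` is a standard chart. -/
noncomputable def chartModulus (π : M → P) (e : OpenPartialHomeomorph M (Fin n → 𝕜))
    (p : P) (i : Fin n) : ℝ :=
  open Classical in if h : ∃ y, π y = p then ‖e h.choose i‖ else 0

variable {e : OpenPartialHomeomorph M (Fin n → 𝕜)} {φ : Gd 𝕜 n ≃ₜ* Gd 𝕜 n}

theorem norm_stdRep (g : Gd 𝕜 n) (z : Fin n → 𝕜) (i : Fin n) : ‖stdRep g z i‖ = ‖z i‖ := by
  simp [stdRep]

theorem chartModulus_apply (hπ : IsGdManifoldOver 𝕜 n P π) (he : IsStandardChart e φ) {x : M}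
    (hx : x ∈ e.source) (i : Fin n) : chartModulus π e (π x) i = ‖e x i‖ := by
  have h : ∃ y, π y = π x := ⟨x, rfl⟩
  obtain ⟨g, hg⟩ := hπ.exists_smul_eq h.choose_spec.symm
  rw [chartModulus, dif_pos h, ← hg, (he g x hx).2, norm_stdRep]

theorem continuousAt_chartModulus [CompactSpace M] [ContinuousSMul (Gd 𝕜 n) M]
    (hπ : IsGdManifoldOver 𝕜 n P π) (he : IsStandardChart e φ) {p : P} (hp : p ∈ π '' e.source) :
    ContinuousAt (chartModulus π e) p := by
  obtain ⟨x, hx, rfl⟩ := hp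
  rw [← hπ.isOpenQuotientMap.continuousAt_comp_iff, continuousAt_pi]
  intro i
  have h1 : ContinuousAt (fun y => ‖e y i‖) x :=
    ((continuous_apply i).continuousAt.comp (e.continuousAt hx)).norm
  refine h1.congr ?_
  filter_upwards [e.open_source.mem_nhds hx] with y hy
  exact (chartModulus_apply hπ he hy i).symm

end OrbitMap

section ZeroSets

variable {𝕜 : Type*} [RCLike 𝕜] {n : ℕ} {M : Type*} [TopologicalSpace M]
  [ChartedSpace (Fin n → 𝕜) M] [MulAction (Gd 𝕜 n) M]
  {ι V : Type*} [Finite ι] [NormedAddCommGroup V] [NormedSpace ℝ V] [FiniteDimensional ℝ V]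
  {f : ι → V →ᵃ[ℝ] ℝ} {π : M → polyhedron f}
  {e : OpenPartialHomeomorph M (Fin n → 𝕜)} {φ : Gd 𝕜 n ≃ₜ* Gd 𝕜 n}

theorem ncard_chartModulus_eq_zero (hdim : affineDim (polyhedron f) = n)
    (hπ : IsGdManifoldOver 𝕜 n (polyhedron f) π) (he : IsStandardChart e φ) {p q : polyhedron f}
    (hp : p ∈ π '' e.source) (hq : q ∈ π '' e.source)
    (hpq : activeSet f (p : V) = activeSet f (q : V)) :
    {i | chartModulus π e p i = 0}.ncard = {i | chartModulus π e q i = 0}.ncard := by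
  obtain ⟨x, hx, rfl⟩ := hp
  obtain ⟨y, hy, rfl⟩ := hq
  simp only [chartModulus_apply hπ he hx, chartModulus_apply hπ he hy, norm_eq_zero]
  have hF := isFace_setOf_activeSet_subset (f := f) (π x).2
  have hxF := mem_intrinsicInterior_setOf_activeSet_subset (f := f) (π x).2
  have hyF := mem_intrinsicInterior_setOf_activeSet_subset (f := f) (π y).2
  rw [← hpq] at hyF
  obtain ⟨j, hj⟩ := Nat.exists_eq_add_of_le (hdim ▸ affineDim_mono hF.2.subset)
  obtain ⟨ψ⟩ := hπ.isotropy x _ hF hxF j hj.symm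
  obtain ⟨χ⟩ := hπ.isotropy y _ hF hyF j hj.symm
  refine Nat.pow_right_injective le_rfl ?_
  simp only
  rw [← he.card_stabilizer_sq_eq_one hx, ← he.card_stabilizer_sq_eq_one hy]
  refine Nat.card_congr ((ψ.trans χ.symm).toMulEquiv.toEquiv.subtypeEquiv fun g => ?_)
  change g ^ 2 = 1 ↔ (ψ.trans χ.symm) g ^ 2 = 1
  rw [← map_pow, EmbeddingLike.map_eq_one_iff]

/-- Over a segment ending in the smallest face of its starting point, the coordinates which vanish
at the start vanish at the end. Indeed the set of vanishing coordinates is upper semicontinuous,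
and before the end its number of elements is constant, so it is locally constant. -/
theorem chartModulus_eq_zero_of_segment [CompactSpace M] [ContinuousSMul (Gd 𝕜 n) M]
    (hdim : affineDim (polyhedron f) = n)
    (hπ : IsGdManifoldOver 𝕜 n (polyhedron f) π) (he : IsStandardChart e φ) {p q : polyhedron f}
    (hpq : activeSet f (p : V) ⊆ activeSet f (q : V))
    (hseg : ∀ t : ℝ, 0 ≤ t → t ≤ 1 → segmentPoint p q t ∈ π '' e.source) {i : Fin n}
    (hi : chartModulus π e p i = 0) : chartModulus π e q i = 0 := by
  have hseg' : ∀ t, segmentPoint p q t ∈ π '' e.source := fun t => by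
    have h := hseg _ (Set.projIcc (0 : ℝ) 1 zero_le_one t).2.1
      (Set.projIcc (0 : ℝ) 1 zero_le_one t).2.2
    simpa [segmentPoint, Set.projIcc_val] using h
  have hcont : Continuous fun t => chartModulus π e (segmentPoint p q t) :=
    continuous_iff_continuousAt.2 fun t =>
      ContinuousAt.comp (continuousAt_chartModulus hπ he (hseg' t))
        (continuous_segmentPoint.comp (by fun_prop : Continuous fun t : ℝ => ((p, q), t))).continuousAt
  have hloc : IsLocallyConstant fun t : Set.Ico (0 : ℝ) 1 =>
      {i | chartModulus π e (segmentPoint p q t) i = 0} := by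
    rw [IsLocallyConstant.iff_eventually_eq]
    intro t
    have hev : ∀ᶠ u : Set.Ico (0 : ℝ) 1 in nhds t, ∀ i,
        chartModulus π e (segmentPoint p q t) i ≠ 0 →
          chartModulus π e (segmentPoint p q u) i ≠ 0 := by
      rw [Filter.eventually_all]
      intro i
      by_cases h : chartModulus π e (segmentPoint p q t) i = 0
      · exact Filter.Eventually.of_forall fun _ h' => absurd h h'
      · have hc : ContinuousAt (fun u : Set.Ico (0 : ℝ) 1 =>
            chartModulus π e (segmentPoint p q u) i) t :=
          ((continuous_apply i).comp (hcont.comp continuous_subtype_val)).continuousAt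
        filter_upwards [hc.eventually_ne h] with u hu _ using hu
    filter_upwards [hev] with u hu
    refine Set.eq_of_subset_of_ncard_le (fun i hi => ?_) (le_of_eq ?_) (Set.toFinite _)
    · by_contra h
      exact hu i h hi
    · refine ncard_chartModulus_eq_zero hdim hπ he (hseg' _) (hseg' _) ?_
      rw [activeSet_segmentPoint hpq t.2.1 t.2.2, activeSet_segmentPoint hpq u.2.1 u.2.2]
  have : PreconnectedSpace (Set.Ico (0 : ℝ) 1) :=
    Subtype.preconnectedSpace isPreconnected_Ico
  have hzero : Set.EqOn (fun t => chartModulus π e (segmentPoint p q t) i) (fun _ => 0)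
      (Set.Ico (0 : ℝ) 1) := fun t ht => by
    have h := hloc.apply_eq_of_preconnectedSpace ⟨t, ht⟩ ⟨0, le_rfl, zero_lt_one⟩
    have h0 : i ∈ {i | chartModulus π e (segmentPoint p q t) i = 0} := by
      dsimp only at h
      rw [h]
      simpa using hi
    exact h0
  have h1 := hzero.closure ((continuous_apply i).comp hcont) continuous_const
    (show (1 : ℝ) ∈ closure (Set.Ico (0 : ℝ) 1) by
      rw [closure_Ico zero_ne_one]; exact ⟨zero_le_one, le_rfl⟩)
  simpa using h1

end ZeroSets

/-! ### Lifting face-preserving motions of the polytope -/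

section RadialLift

variable {𝕜 : Type*} [RCLike 𝕜] {n : ℕ}

/-- The vector with the phases of `z` and the moduli `ρ`. The phase of `0` is the junk value `0`, so
that coordinates which vanish for `z` remain zero. -/
noncomputable def radialLift (z : Fin n → 𝕜) (ρ : Fin n → ℝ) : Fin n → 𝕜 :=
  fun i => (ρ i : 𝕜) * (z i / (‖z i‖ : 𝕜))

/-- The phase is discontinuous at `0`, but this does not matter where the new modulus vanishes. -/
theorem continuousOn_radialLift :
    ContinuousOn (fun w : (Fin n → 𝕜) × (Fin n → ℝ) => radialLift w.1 w.2)
      {w | ∀ i, w.1 i = 0 → w.2 i = 0} := by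
  rintro ⟨z, ρ⟩ hw
  refine continuousWithinAt_pi.2 fun i => ContinuousAt.continuousWithinAt ?_
  have hz : Continuous fun w : (Fin n → 𝕜) × (Fin n → ℝ) => w.1 i := by fun_prop
  have hρ : Continuous fun w : (Fin n → 𝕜) × (Fin n → ℝ) => (w.2 i : 𝕜) :=
    RCLike.continuous_ofReal.comp (by fun_prop)
  by_cases hi : z i = 0
  · have hρi : ρ i = 0 := hw i hi
    have h0 : radialLift z ρ i = 0 := by simp [radialLift, hρi]
    rw [ContinuousAt]
    dsimp only
    rw [h0]
    refine squeeze_zero_norm (a := fun w : (Fin n → 𝕜) × (Fin n → ℝ) => ‖(w.2 i : 𝕜)‖) ?_ ?_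
    · intro w
      simp only [radialLift, norm_mul, norm_div, RCLike.norm_ofReal, abs_norm]
      exact mul_le_of_le_one_right (abs_nonneg _) (div_self_le_one _)
    · have := (hρ.norm).tendsto (z, ρ)
      simpa [hρi] using this
  · refine hρ.continuousAt.mul (hz.continuousAt.div ?_ ?_)
    · exact (RCLike.continuous_ofReal.comp hz.norm).continuousAt
    · simpa using hi

theorem radialLift_norm (z : Fin n → 𝕜) : radialLift z (fun i => ‖z i‖) = z := by
  funext i
  by_cases hi : z i = 0
  · simp [radialLift, hi]
  · have : (‖z i‖ : 𝕜) ≠ 0 := by simpa using hi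
    simp only [radialLift]
    field_simp

theorem radialLift_stdRep (g : Gd 𝕜 n) (z : Fin n → 𝕜) (ρ : Fin n → ℝ) :
    radialLift (stdRep g z) ρ = stdRep g (radialLift z ρ) := by
  funext i
  rw [radialLift, norm_stdRep]
  simp only [radialLift, stdRep, mul_div_assoc, mul_left_comm]

/-- Changing the phases of `z'` to those of `z` is the action of a group element. -/
theorem exists_stdRep_eq_radialLift {z z' : Fin n → 𝕜} (h : ∀ i, z i = 0 → z' i = 0) :
    ∃ g : Gd 𝕜 n, stdRep g z' = radialLift z fun i => ‖z' i‖ := by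
  have : ∀ i, ∃ s : Metric.sphere (0 : 𝕜) 1,
      (s : 𝕜) * z' i = (‖z' i‖ : 𝕜) * (z i / (‖z i‖ : 𝕜)) := fun i => by
    by_cases hi : z' i = 0
    · exact ⟨1, by simp [hi]⟩
    · have hzi : z i ≠ 0 := fun h0 => hi (h i h0)
      refine ⟨⟨(‖z' i‖ : 𝕜) * (z i / (‖z i‖ : 𝕜)) / z' i, ?_⟩, ?_⟩
      · have h1 : ‖z' i‖ ≠ 0 := by simpa using hi
        have h2 : ‖z i‖ ≠ 0 := by simpa using hzi
        simp [h1, h2]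
      · exact div_mul_cancel₀ _ hi
  choose g hg using this
  exact ⟨g, funext hg⟩

end RadialLift

section ChartLift

variable {𝕜 : Type*} [RCLike 𝕜] {n : ℕ} {M : Type*} [TopologicalSpace M]
  [ChartedSpace (Fin n → 𝕜) M] [MulAction (Gd 𝕜 n) M]
  {V : Type*} [NormedAddCommGroup V] [NormedSpace ℝ V] {P : Set V} {π : M → P}

/-- The point over `p` with the same phases in the chart `e` as `y`. -/
noncomputable def chartLift (π : M → P) (e : OpenPartialHomeomorph M (Fin n → 𝕜)) (y : M) (p : P) :
    M :=
  e.symm (radialLift (e y) (chartModulus π e p))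

/-- The pairs of a point `y` in the chart `e` and a point `p` such that the coordinates of `y` which
vanish also vanish over `p`. -/
def chartLiftDomain (π : M → P) (e : OpenPartialHomeomorph M (Fin n → 𝕜)) : Set (M × P) :=
  {z | z.1 ∈ e.source ∧ z.2 ∈ π '' e.source ∧
    ∀ i, chartModulus π e (π z.1) i = 0 → chartModulus π e z.2 i = 0}

variable {e : OpenPartialHomeomorph M (Fin n → 𝕜)} {φ : Gd 𝕜 n ≃ₜ* Gd 𝕜 n}

theorem exists_radialLift_eq (hπ : IsGdManifoldOver 𝕜 n P π) (he : IsStandardChart e φ) {y : M}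
    {p : P} (h : (y, p) ∈ chartLiftDomain π e) :
    ∃ x ∈ e.source, π x = p ∧ e x = radialLift (e y) (chartModulus π e p) := by
  obtain ⟨hy, ⟨x, hx, rfl⟩, hzero⟩ := h
  simp only [chartModulus_apply hπ he hy, chartModulus_apply hπ he hx, norm_eq_zero] at hzero
  obtain ⟨g, hg⟩ := exists_stdRep_eq_radialLift hzero
  have := he (φ.symm g) x hx
  refine ⟨φ.symm g • x, this.1, hπ.map_smul _ _, ?_⟩
  rw [this.2, ContinuousMulEquiv.apply_symm_apply, hg]
  congr 1
  funext i
  exact (chartModulus_apply hπ he hx i).symm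

theorem map_chartLift (hπ : IsGdManifoldOver 𝕜 n P π) (he : IsStandardChart e φ) {y : M}
    {p : P} (h : (y, p) ∈ chartLiftDomain π e) : π (chartLift π e y p) = p := by
  obtain ⟨x, hx, hxp, hxe⟩ := exists_radialLift_eq hπ he h
  rw [chartLift, ← hxe, e.left_inv hx, hxp]

theorem chartLift_self (hπ : IsGdManifoldOver 𝕜 n P π) (he : IsStandardChart e φ) {y : M}
    (hy : y ∈ e.source) : chartLift π e y (π y) = y := by
  have : chartModulus π e (π y) = fun i => ‖e y i‖ := funext (chartModulus_apply hπ he hy)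
  rw [chartLift, this, radialLift_norm, e.left_inv hy]

theorem chartLift_smul (hπ : IsGdManifoldOver 𝕜 n P π) (he : IsStandardChart e φ) {y : M}
    {p : P} (h : (y, p) ∈ chartLiftDomain π e) (g : Gd 𝕜 n) :
    chartLift π e (g • y) p = g • chartLift π e y p := by
  obtain ⟨x, hx, hxp, hxe⟩ := exists_radialLift_eq hπ he h
  rw [chartLift, (he g y h.1).2, radialLift_stdRep, chartLift, ← hxe, ← (he g x hx).2,
    e.left_inv hx, e.left_inv (he g x hx).1]

theorem continuousOn_chartLift [CompactSpace M] [ContinuousSMul (Gd 𝕜 n) M]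
    (hπ : IsGdManifoldOver 𝕜 n P π) (he : IsStandardChart e φ) :
    ContinuousOn (fun z : M × P => chartLift π e z.1 z.2) (chartLiftDomain π e) := by
  have h1 : ContinuousOn (fun z : M × P => (e z.1, chartModulus π e z.2)) (chartLiftDomain π e) := by
    intro z hz
    refine ContinuousWithinAt.prodMk ?_ ?_
    · exact ((e.continuousAt hz.1).comp continuousAt_fst).continuousWithinAt
    · exact ((continuousAt_chartModulus hπ he hz.2.1).comp continuousAt_snd).continuousWithinAt
  refine e.continuousOn_symm.comp (continuousOn_radialLift.comp h1 ?_) ?_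
  · intro z hz i hi
    refine hz.2.2 i ?_
    rw [chartModulus_apply hπ he hz.1, norm_eq_zero]
    exact hi
  · intro z hz
    obtain ⟨x, hx, hxp, hxe⟩ := exists_radialLift_eq hπ he hz
    change radialLift (e z.1) (chartModulus π e z.2) ∈ e.target
    rw [← hxe]
    exact e.map_source hx

end ChartLift

section LiftsAlong

open scoped NNReal

variable {𝕜 : Type*} [RCLike 𝕜] {n : ℕ} {M : Type*} [TopologicalSpace M]
  [ChartedSpace (Fin n → 𝕜) M] [MulAction (Gd 𝕜 n) M]
  {ι V : Type*} [NormedAddCommGroup V] [NormedSpace ℝ V]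
  {f : ι → V →ᵃ[ℝ] ℝ} {π : M → polyhedron f}

/-- The pairs of a point `x` of `M` and a point in the smallest face containing `π x`. -/
abbrev LiftDomain (π : M → polyhedron f) : Type _ :=
  {z : M × polyhedron f // activeSet f (π z.1 : V) ⊆ activeSet f (z.2 : V)}

variable (𝕜 n) in
/-- The motion of `π x` towards a point `q` of its smallest face, by the fraction `s (π x, q)` of the
way, lifts to a continuous equivariant motion of `x` which is constant if `q = π x`. -/
def LiftsAlong (π : M → polyhedron f) (s : polyhedron f × polyhedron f → ℝ) : Prop :=
  ∃ Λ : LiftDomain π → M, Continuous Λ ∧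
    (∀ z, π (Λ z) = segmentPoint (π z.1.1) z.1.2 (s (π z.1.1, z.1.2))) ∧
    (∀ z, π z.1.1 = z.1.2 → Λ z = z.1.1) ∧
    ∀ (g : Gd 𝕜 n) z z', z'.1 = (g • z.1.1, z.1.2) → Λ z' = g • Λ z

variable [Finite ι] [FiniteDimensional ℝ V] [CompactSpace M] [ContinuousSMul (Gd 𝕜 n) M]

/-- A lift can be continued through one standard chart. -/
theorem LiftsAlong.step (hdim : affineDim (polyhedron f) = n)
    (hπ : IsGdManifoldOver 𝕜 n (polyhedron f) π) {e : OpenPartialHomeomorph M (Fin n → 𝕜)}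
    {φ : Gd 𝕜 n ≃ₜ* Gd 𝕜 n} (he : IsStandardChart e φ)
    {s s' : polyhedron f × polyhedron f → ℝ} (hs : LiftsAlong 𝕜 n π s) (hs' : Continuous s')
    {C C' : Set (polyhedron f × polyhedron f)} (hC : IsClosed C) (hC' : IsClosed C')
    (hCC' : C ∪ C' = Set.univ) (heq : ∀ z ∈ C', s' z = s z)
    (hle : ∀ z ∈ C, 0 ≤ s z ∧ s z ≤ s' z ∧ s' z ≤ 1)
    (hmem : ∀ z ∈ C, ∀ t, s z ≤ t → t ≤ s' z → segmentPoint z.1 z.2 t ∈ π '' e.source) :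
    LiftsAlong 𝕜 n π s' := by
  classical
  obtain ⟨Λ, hΛ, hΛπ, hΛid, hΛg⟩ := hs
  let pr : LiftDomain π → polyhedron f × polyhedron f := fun z => (π z.1.1, z.1.2)
  have hpr : Continuous pr :=
    (hπ.continuous.comp (continuous_fst.comp continuous_subtype_val)).prodMk
      (continuous_snd.comp continuous_subtype_val)
  let q : LiftDomain π → polyhedron f := fun z => segmentPoint (π z.1.1) z.1.2 (s' (pr z))
  have hq : Continuous q := continuous_segmentPoint.comp (hpr.prodMk (hs'.comp hpr))
  have hsource : ∀ x, π x ∈ π '' e.source → x ∈ e.source := by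
    rintro x ⟨y, hy, hyx⟩
    obtain ⟨g, rfl⟩ := hπ.exists_smul_eq hyx
    exact (he g y hy).1
  have hdom : ∀ z, pr z ∈ C → (Λ z, q z) ∈ chartLiftDomain π e := by
    intro z hz
    obtain ⟨h0, h1, h2⟩ := hle _ hz
    refine ⟨hsource _ ?_, hmem _ hz _ h1 le_rfl, fun i hi => ?_⟩
    · rw [hΛπ]
      exact hmem _ hz _ le_rfl h1
    · refine chartModulus_eq_zero_of_segment hdim hπ he ?_ (fun t ht0 ht1 => ?_) hi
      · rw [hΛπ]
        exact activeSet_segmentPoint_subset z.2 h0 h1 h2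
      · rw [hΛπ, segmentPoint_segmentPoint _ _ h0 h1 h2 ht0 ht1]
        have h3 := mul_nonneg ht0 (sub_nonneg.2 h1)
        have h4 := mul_le_of_le_one_left (sub_nonneg.2 h1) ht1
        exact hmem _ hz _ (by linarith) (by linarith)
  have hqC' : ∀ z, pr z ∈ C' → q z = π (Λ z) := by
    intro z hz
    rw [hΛπ]
    simp only [q, pr, heq _ hz]
  let Λ' : LiftDomain π → M := fun z => if pr z ∈ C then chartLift π e (Λ z) (q z) else Λ z
  have hΛ'C : ∀ z, pr z ∈ C → Λ' z = chartLift π e (Λ z) (q z) := fun z hz => if_pos hz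
  have hΛ'C' : ∀ z, pr z ∈ C' → Λ' z = Λ z := by
    intro z hz
    by_cases h : pr z ∈ C
    · rw [hΛ'C z h, hqC' z hz, chartLift_self hπ he (hdom z h).1]
    · exact if_neg h
  have hcases : ∀ z, pr z ∈ C ∨ pr z ∈ C' := fun z => by
    rw [← Set.mem_union, hCC']
    exact Set.mem_univ _
  refine ⟨Λ', ?_, fun z => ?_, fun z hz => ?_, fun g z z' hzz' => ?_⟩
  · have h0 : ContinuousOn (fun z => chartLift π e (Λ z) (q z)) (pr ⁻¹' C) :=
      ContinuousOn.comp (f := fun z => (Λ z, q z)) (continuousOn_chartLift hπ he)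
        (hΛ.prodMk hq).continuousOn hdom
    have h1 : ContinuousOn Λ' (pr ⁻¹' C) := h0.congr hΛ'C
    have h2 : ContinuousOn Λ' (pr ⁻¹' C') := hΛ.continuousOn.congr fun z hz => hΛ'C' z hz
    have h3 := h1.union_of_isClosed h2 (hC.preimage hpr) (hC'.preimage hpr)
    rwa [← Set.preimage_union, hCC', Set.preimage_univ, continuousOn_univ] at h3
  · change π (Λ' z) = q z
    rcases hcases z with h | h
    · rw [hΛ'C z h, map_chartLift hπ he (hdom z h)]
    · rw [hΛ'C' z h, hqC' z h]
  · rcases hcases z with h | h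
    · have hqz : q z = π (Λ z) := by
        rw [hΛid z hz]
        simp only [q, hz, segmentPoint_self]
      rw [hΛ'C z h, hqz, chartLift_self hπ he (hdom z h).1, hΛid z hz]
    · rw [hΛ'C' z h, hΛid z hz]
  · have hz1 : z'.1.1 = g • z.1.1 := (Prod.ext_iff.1 hzz').1
    have hz2 : z'.1.2 = z.1.2 := (Prod.ext_iff.1 hzz').2
    have hprz : pr z' = pr z := by
      simp only [pr, hz1, hz2, hπ.map_smul]
    have hqz : q z' = q z := by
      simp only [q, hprz, hz1, hz2, hπ.map_smul]
    rcases hcases z with h | h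
    · rw [hΛ'C z' (hprz ▸ h), hΛ'C z h, hqz, hΛg g z z' hzz', chartLift_smul hπ he (hdom z h)]
    · rw [hΛ'C' z' (hprz ▸ h), hΛ'C' z h, hΛg g z z' hzz']

/-- The whole motion along segments lifts. The segment is divided into `N` short pieces, and each
piece is traversed in finitely many steps, one for each member of a finite cover by charts, with
bump functions deciding how far to go in each step. -/
theorem liftsAlong_one (hdim : affineDim (polyhedron f) = n)
    (hb : Bornology.IsBounded (polyhedron f))
    (hπ : IsGdManifoldOver 𝕜 n (polyhedron f) π) : LiftsAlong 𝕜 n π fun _ => 1 := by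
  classical
  have : CompactSpace (polyhedron f) :=
    isCompact_univ_iff.1 (Set.range_eq_univ.2 hπ.surjective ▸ isCompact_range hπ.continuous)
  choose e he hp using hπ.exists_isStandardChart
  obtain ⟨δ, hδ, hball⟩ := lebesgue_number_lemma_of_metric (isCompact_univ (X := polyhedron f))
    (c := fun p => π '' (e p).source)
    (fun p => hπ.isOpenQuotientMap.isOpenMap _ (e p).open_source)
    (fun p _ => Set.mem_iUnion.2 ⟨p, hp p⟩)
  choose! k hk using hball
  obtain ⟨T, -, hTfin, hT⟩ := finite_cover_balls_of_compact (isCompact_univ (X := polyhedron f))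
    (show 0 < δ / 3 by positivity)
  lift T to Finset (polyhedron f) using hTfin
  obtain ⟨R, hR⟩ := Metric.isBounded_iff.1 hb
  have hdist : ∀ p q : polyhedron f, dist p q ≤ R := fun p q => hR p.2 q.2
  obtain ⟨N, hN⟩ := exists_nat_gt (max 1 (3 * R / δ))
  have hN0 : (0 : ℝ) < N := lt_of_lt_of_le zero_lt_one ((le_max_left _ _).trans hN.le)
  have hRN : R / N < δ / 3 := by
    have := (le_max_right _ _).trans_lt hN
    rw [div_lt_iff₀ hδ] at this
    rw [div_lt_iff₀ hN0]
    linarith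
  -- The bump function of `c` is `1` at distance at most `δ / 3` from `c` and `0` from `2 * δ / 3` on.
  let χ : polyhedron f → polyhedron f → ℝ≥0 := fun c p =>
    (min 1 (2 - 3 * dist p c / δ)).toNNReal
  have hχ : ∀ c, Continuous (χ c) := fun c =>
    continuous_real_toNNReal.comp (by fun_prop)
  have hχ1 : ∀ c p, χ c p ≤ 1 := fun c p => Real.toNNReal_le_one.2 (min_le_left _ _)
  let y : ℕ → polyhedron f × polyhedron f → polyhedron f := fun l z => segmentPoint z.1 z.2 (l / N)
  have hy : ∀ l, Continuous (y l) := fun l =>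
    continuous_segmentPoint.comp (continuous_id.prodMk continuous_const)
  let σ : ℕ → Finset (polyhedron f) → polyhedron f × polyhedron f → ℝ := fun l S z =>
    (l + (S.sup fun c => χ c (y l z) : ℝ≥0)) / N
  have hσ : ∀ l S, Continuous (σ l S) := fun l S => by
    have : Continuous fun z => S.sup fun c => χ c (y l z) :=
      Continuous.finset_sup_apply fun c _ => (hχ c).comp (hy l)
    fun_prop
  have hσle : ∀ l S z, σ l S z ≤ (l + 1) / N := fun l S z => by
    have : (S.sup fun c => χ c (y l z)) ≤ 1 := Finset.sup_le fun c _ => hχ1 c _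
    have : ((S.sup fun c => χ c (y l z) : ℝ≥0) : ℝ) ≤ 1 := by exact_mod_cast this
    simp only [σ]
    gcongr
  have hσge : ∀ l S z, l / N ≤ σ l S z := fun l S z => by
    simp only [σ]
    gcongr
    simp
  have hstep : ∀ l, l + 1 ≤ N → LiftsAlong 𝕜 n π (fun _ => (l : ℝ) / N) →
      ∀ S, LiftsAlong 𝕜 n π (σ l S) := by
    intro l hl h0 S
    have hl1 : ((l : ℝ) + 1) / N ≤ 1 := by
      rw [div_le_one hN0]
      exact_mod_cast hl
    have hl0 : (0 : ℝ) ≤ l / N := by positivity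
    induction S using Finset.induction_on with
    | empty =>
      convert h0 using 2
      simp [σ]
    | insert c S _ ih =>
      obtain ⟨ψ, hψ⟩ := he (k c)
      refine ih.step (C := {z | dist (y l z) c ≤ 2 * δ / 3}) (C' := {z | 2 * δ / 3 ≤ dist (y l z) c})
        hdim hπ hψ (hσ _ _) (isClosed_le (by fun_prop) continuous_const)
        (isClosed_le continuous_const (by fun_prop))
        (Set.eq_univ_of_forall fun z => le_total (dist (y l z) c) (2 * δ / 3)) ?_ ?_ ?_
      · intro z hz
        have hz : 2 * δ / 3 ≤ dist (y l z) c := hz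
        have : χ c (y l z) = 0 := by
          refine Real.toNNReal_of_nonpos ((min_le_right _ _).trans ?_)
          rw [sub_nonpos, le_div_iff₀ hδ]
          linarith
        simp [σ, this]
      · refine fun z _ => ⟨hl0.trans (hσge _ _ _), ?_, (hσle _ _ _).trans hl1⟩
        simp only [σ]
        gcongr
        exact Finset.subset_insert _ _
      · intro z hz t ht0 ht1
        have hz : dist (y l z) c ≤ 2 * δ / 3 := hz
        refine hk c (Set.mem_univ _) ?_
        have h1 := (hσge l S z).trans ht0
        have h2 := ht1.trans (hσle l _ z)
        have hlN : (l : ℝ) / N ≤ 1 := h1.trans (h2.trans hl1)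
        have h3 : dist (segmentPoint z.1 z.2 t) (y l z) ≤ R / N := by
          rw [dist_segmentPoint _ _ (hl0.trans h1) (h2.trans hl1) hl0 hlN,
            abs_of_nonneg (sub_nonneg.2 h1)]
          have h4 : t - l / N ≤ 1 / N := by
            rw [add_div] at h2
            linarith
          calc (t - l / N) * dist z.1 z.2 ≤ 1 / N * R :=
                mul_le_mul h4 (hdist _ _) dist_nonneg (by positivity)
            _ = R / N := by ring
        rw [Metric.mem_ball]
        linarith [dist_triangle (segmentPoint z.1 z.2 t) (y l z) c]
  have hσT : ∀ l, σ l T = fun _ => ((l + 1 : ℕ) : ℝ) / N := fun l => by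
    funext z
    refine le_antisymm (by simpa using hσle l T z) ?_
    obtain ⟨c, hc, hcz⟩ := Set.mem_iUnion₂.1 (hT (Set.mem_univ (y l z)))
    have h1 : χ c (y l z) = 1 := by
      have h2 : 1 ≤ 2 - 3 * dist (y l z) c / δ := by
        have hcz : dist (y l z) c < δ / 3 := hcz
        rw [le_sub_comm, div_le_iff₀ hδ]
        linarith
      simp [χ, min_eq_left h2]
    have h2 : 1 ≤ T.sup fun c => χ c (y l z) :=
      h1 ▸ Finset.le_sup (f := fun c => χ c (y l z)) hc
    have h3 : (1 : ℝ) ≤ (T.sup fun c => χ c (y l z) : ℝ≥0) := by exact_mod_cast h2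
    simp only [σ]
    push_cast
    gcongr
  have hmain : ∀ l ≤ N, LiftsAlong 𝕜 n π fun _ => (l : ℝ) / N := by
    intro l
    induction l with
    | zero =>
      intro _
      refine ⟨fun z => z.1.1, by fun_prop, fun z => by simp, fun _ _ => rfl, ?_⟩
      exact fun g z z' h => congrArg Prod.fst h
    | succ l ih =>
      intro hl
      have := hstep l hl (ih (by omega)) T
      rwa [hσT] at this
  have := hmain N le_rfl
  rwa [div_self hN0.ne'] at this

/-- Points of `M` can be moved continuously and equivariantly over the points of the smallest face of
their image. -/
theorem exists_equivariant_lift (hdim : affineDim (polyhedron f) = n)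
    (hb : Bornology.IsBounded (polyhedron f))
    (hπ : IsGdManifoldOver 𝕜 n (polyhedron f) π) :
    ∃ Λ : LiftDomain π → M, Continuous Λ ∧ (∀ z, π (Λ z) = z.1.2) ∧
      (∀ z, π z.1.1 = z.1.2 → Λ z = z.1.1) ∧
      ∀ (g : Gd 𝕜 n) z z', z'.1 = (g • z.1.1, z.1.2) → Λ z' = g • Λ z := by
  obtain ⟨Λ, h1, h2, h3, h4⟩ := liftsAlong_one hdim hb hπ
  exact ⟨Λ, h1, fun z => by simp [h2], h3, h4⟩

end LiftsAlong

/-! ### The deformation of the orbit configuration space -/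

theorem mem_orbitConfig_two_iff {𝕜 : Type*} [RCLike 𝕜] {n : ℕ} {M : Type*} [TopologicalSpace M]
    [ChartedSpace (Fin n → 𝕜) M] [MulAction (Gd 𝕜 n) M]
    {V : Type*} [NormedAddCommGroup V] [NormedSpace ℝ V] {P : Set V} {π : M → P}
    (hπ : IsGdManifoldOver 𝕜 n P π) {x : Fin 2 → M} :
    x ∈ orbitConfig (Gd 𝕜 n) M 2 ↔ (π (x 0) : V) ≠ π (x 1) := by
  have key : ∀ i j, MulAction.orbit (Gd 𝕜 n) (x i) ∩ MulAction.orbit (Gd 𝕜 n) (x j) = ∅ ↔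
      (π (x i) : V) ≠ π (x j) := fun i j => by
    rw [← Set.disjoint_iff_inter_eq_empty, Ne, ← Subtype.ext_iff, hπ.fibre_eq_orbit]
    constructor
    · intro h hmem
      exact Set.disjoint_left.1 h hmem (MulAction.mem_orbit_self _)
    · intro h
      rw [Set.disjoint_left]
      intro z hz1 hz2
      refine h ?_
      rw [← MulAction.orbit_eq_iff.2 hz1, MulAction.orbit_eq_iff.2 hz2]
      exact MulAction.mem_orbit_self _
  constructor
  · intro h
    exact (key 0 1).1 (h 0 1 (by decide))
  · intro h i j hij
    rw [key]
    fin_cases i <;> fin_cases j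
    · exact absurd rfl hij
    · exact h
    · exact h.symm
    · exact absurd rfl hij

/-- Membership in `X_d(M)` only has to be tested on the smallest faces containing the two images. -/
theorem mem_disjointFacePreimages_polyhedron_iff {ι M V : Type*} [Finite ι] [NormedAddCommGroup V]
    [NormedSpace ℝ V] [FiniteDimensional ℝ V] {f : ι → V →ᵃ[ℝ] ℝ} {π : M → polyhedron f}
    {x : Fin 2 → M} :
    x ∈ disjointFacePreimages (polyhedron f) π ↔ ∀ y ∈ polyhedron f,
      activeSet f (π (x 0) : V) ⊆ activeSet f y → ¬ activeSet f (π (x 1) : V) ⊆ activeSet f y := by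
  simp only [disjointFacePreimages, Set.mem_iUnion, exists_prop, Set.mem_ofPred_eq]
  constructor
  · rintro ⟨F₁, F₂, hF₁, hF₂, hdisj, h1, h2⟩ y hy hy1 hy2
    have : y ∈ F₁ ∩ F₂ :=
      ⟨hF₁.mem_of_activeSet_subset h1 hy hy1, hF₂.mem_of_activeSet_subset h2 hy hy2⟩
    rw [hdisj] at this
    exact this
  · intro h
    refine ⟨_, _, isFace_setOf_activeSet_subset (π (x 0)).2,
      isFace_setOf_activeSet_subset (π (x 1)).2, ?_, ⟨(π (x 0)).2, subset_rfl⟩,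
      ⟨(π (x 1)).2, subset_rfl⟩⟩
    rw [Set.eq_empty_iff_forall_notMem]
    rintro y ⟨⟨hy, hy1⟩, -, hy2⟩
    exact h y hy hy1 hy2

/-- The retraction of pairs of distinct points of the polytope onto pairs in disjoint faces never
takes a point out of its smallest face, so it lifts to `M × M`. -/
theorem exists_retraction_over_polyhedron {𝕜 : Type*} [RCLike 𝕜] {n : ℕ}
    {ι V : Type*} [Finite ι] [NormedAddCommGroup V] [NormedSpace ℝ V] [FiniteDimensional ℝ V]
    {f : ι → V →ᵃ[ℝ] ℝ} (hb : Bornology.IsBounded (polyhedron f))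
    (hdim : affineDim (polyhedron f) = n)
    {M : Type*} [TopologicalSpace M] [CompactSpace M]
    [ChartedSpace (Fin n → 𝕜) M] [MulAction (Gd 𝕜 n) M] [ContinuousSMul (Gd 𝕜 n) M]
    {π : M → polyhedron f} (hπ : IsGdManifoldOver 𝕜 n (polyhedron f) π) :
    ∃ H : orbitConfig (Gd 𝕜 n) M 2 × unitInterval → orbitConfig (Gd 𝕜 n) M 2,
      IsEquivariantStrongDeformationRetraction (Gd 𝕜 n)
        (orbitConfig (Gd 𝕜 n) M 2) (disjointFacePreimages (polyhedron f) π) H := by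
  have := Fintype.ofFinite ι
  obtain ⟨h, h0, h1, hfix, hface⟩ := exists_retraction_onto_disjoint_faces hb
  obtain ⟨Λ, hΛ, hΛπ, hΛid, hΛg⟩ := exists_equivariant_lift hdim hb hπ
  let b : orbitConfig (Gd 𝕜 n) M 2 → DistinctPairs (polyhedron f) := fun x =>
    ⟨(π (x.1 0), π (x.1 1)), (π (x.1 0)).2, (π (x.1 1)).2, (mem_orbitConfig_two_iff hπ).1 x.2⟩
  have hpt : ∀ i, Continuous fun x : orbitConfig (Gd 𝕜 n) M 2 => x.1 i := fun i =>
    (continuous_apply i).comp continuous_subtype_val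
  have hbc : Continuous b := by
    exact Continuous.subtype_mk
      ((continuous_subtype_val.comp (hπ.continuous.comp (hpt 0))).prodMk
        (continuous_subtype_val.comp (hπ.continuous.comp (hpt 1)))) _
  let d0 : orbitConfig (Gd 𝕜 n) M 2 × unitInterval → LiftDomain π := fun z =>
    ⟨(z.1.1 0, ⟨(h (b z.1, z.2)).1.1, (h (b z.1, z.2)).2.1⟩), (hface (b z.1) z.2).1⟩
  let d1 : orbitConfig (Gd 𝕜 n) M 2 × unitInterval → LiftDomain π := fun z =>
    ⟨(z.1.1 1, ⟨(h (b z.1, z.2)).1.2, (h (b z.1, z.2)).2.2.1⟩), (hface (b z.1) z.2).2⟩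
  have hhb : Continuous fun z : orbitConfig (Gd 𝕜 n) M 2 × unitInterval => (h (b z.1, z.2)).1 := by
    fun_prop
  have hd0 : Continuous d0 :=
    Continuous.subtype_mk (((hpt 0).comp continuous_fst).prodMk (hhb.fst.subtype_mk _)) _
  have hd1 : Continuous d1 :=
    Continuous.subtype_mk (((hpt 1).comp continuous_fst).prodMk (hhb.snd.subtype_mk _)) _
  have hπ0 : ∀ z, (π (Λ (d0 z)) : V) = (h (b z.1, z.2)).1.1 := fun z => by rw [hΛπ]
  have hπ1 : ∀ z, (π (Λ (d1 z)) : V) = (h (b z.1, z.2)).1.2 := fun z => by rw [hΛπ]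
  have hconst : ∀ z, h (b z.1, z.2) = b z.1 → ![Λ (d0 z), Λ (d1 z)] = z.1.1 := by
    intro z hz
    have e0 : Λ (d0 z) = z.1.1 0 := hΛid (d0 z) (Subtype.ext (by
      change _ = (h (b z.1, z.2)).1.1
      rw [hz]))
    have e1 : Λ (d1 z) = z.1.1 1 := hΛid (d1 z) (Subtype.ext (by
      change _ = (h (b z.1, z.2)).1.2
      rw [hz]))
    rw [e0, e1]
    funext i
    fin_cases i <;> rfl
  refine ⟨fun z => ⟨![Λ (d0 z), Λ (d1 z)], ?_⟩, ?_, ?_, ?_, ?_, ?_, ?_, ?_⟩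
  · rw [mem_orbitConfig_two_iff hπ]
    change (π (Λ (d0 z)) : V) ≠ π (Λ (d1 z))
    rw [hπ0, hπ1]
    exact (h (b z.1, z.2)).2.2.2
  · intro x hx
    rw [mem_orbitConfig_two_iff hπ]
    rw [mem_disjointFacePreimages_polyhedron_iff] at hx
    intro heq
    exact hx _ (π (x 1)).2 (by rw [heq]) subset_rfl
  · intro g x hx
    rw [mem_orbitConfig_two_iff hπ] at hx ⊢
    rwa [hπ.map_smul, hπ.map_smul]
  · refine Continuous.subtype_mk (continuous_pi fun i => ?_) _
    fin_cases i
    · exact hΛ.comp hd0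
    · exact hΛ.comp hd1
  · exact fun x => Subtype.ext (hconst (x, 0) (h0 _))
  · intro x
    rw [mem_disjointFacePreimages_polyhedron_iff]
    change ∀ y ∈ polyhedron f, activeSet f (π (Λ (d0 (x, 1))) : V) ⊆ activeSet f y →
      ¬ activeSet f (π (Λ (d1 (x, 1))) : V) ⊆ activeSet f y
    rw [hπ0, hπ1]
    exact h1 (b x)
  · intro x t hx
    rw [mem_disjointFacePreimages_polyhedron_iff] at hx
    exact Subtype.ext (hconst (x, t) (hfix (b x) hx t))
  · intro g x y t hxy
    have hy : ∀ i, y.1 i = g i • x.1 i := fun i => congrFun hxy i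
    have hby : b y = b x := Subtype.ext (by simp only [b, hy, hπ.map_smul])
    have e0 : (d0 (y, t)).1 = (g 0 • (d0 (x, t)).1.1, (d0 (x, t)).1.2) := by
      simp only [d0, hby, hy]
    have e1 : (d1 (y, t)).1 = (g 1 • (d1 (x, t)).1.1, (d1 (x, t)).1.2) := by
      simp only [d1, hby, hy]
    funext i
    fin_cases i
    · exact hΛg (g 0) _ _ e0
    · exact hΛg (g 1) _ _ e1

/-- The case `𝕜 = ℝ` is that of small covers (`d = 1`), the case `𝕜 = ℂ` that of quasi-toric
manifolds (`d = 2`). -/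
theorem theorem1p4 {𝕜 : Type*} [RCLike 𝕜] (n : ℕ)
    {V : Type*} [NormedAddCommGroup V] [NormedSpace ℝ V] [FiniteDimensional ℝ V]
    (P : Set V) (hP : IsSimplePolytope n P)
    {M : Type*} [TopologicalSpace M] [T2Space M] [CompactSpace M]
    [ChartedSpace (Fin n → 𝕜) M] [IsManifold 𝓘(ℝ, Fin n → 𝕜) ∞ M]
    [MulAction (Gd 𝕜 n) M] [ContinuousSMul (Gd 𝕜 n) M]
    (π : M → P) (hπ : IsGdManifoldOver 𝕜 n P π) :
    ∃ H : orbitConfig (Gd 𝕜 n) M 2 × unitInterval → orbitConfig (Gd 𝕜 n) M 2,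
      IsEquivariantStrongDeformationRetraction (Gd 𝕜 n)
        (orbitConfig (Gd 𝕜 n) M 2) (disjointFacePreimages P π) H := by
  obtain ⟨s, hs, hPs⟩ := hP.isPolytope
  obtain ⟨S, hS, hsS⟩ := hs.exists_finite_convexHull_eq
  have : Finite S := hS
  have hPf : P = polyhedron fun g : S => (g : V →ᵃ[ℝ] ℝ) := by
    rw [hPs, hsS]
    ext x
    simp [polyhedron]
  have hb : Bornology.IsBounded P := hPs ▸ isBounded_convexHull.2 hs.isBounded
  have hdim := hP.dim_eq
  subst hPf
  exact exists_retraction_over_polyhedron hb hdim hπ
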